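/- Let $G$ be a second countable locally compact Hausdorff groupoid with unit space $G^0$, range and source maps $r,s$, and a left Haar system $u\mapsto\lambda^u$ on the fibres $G^u=r^{-1}(u)$; let $\lambda_u$ be the image of $\lambda^u$ under inversion, a measure on $G_u=s^{-1}(u)$. On $C_c(G)$ put $f*F(x)=\int f(t)F(t^{-1}x)\,d\lambda^{r(x)}(t)$, $F^*(x)=\overline{F(x^{-1})}$, $F^\vee(x)=F(x^{-1})$ and $$\|F\|_I=\max\Big\{\sup_{u}\int|F|\,d\lambda^u,\ \sup_u\int|F|\,d\lambda_u\Big\},\qquad \|F\|_{red}=\sup_{u}\|\pi_u(F)\|,$$ where $\pi_u(F)\xi(x)=\int F(t)\xi(t^{-1}x)\,d\lambda^{r(x)}(t)$ on $L^2(G_u,\lambda_u)$; $C^*_{red}(G)$ is the completion of $(C_c(G),\|\cdot\|_{red})$. Let $E^2$ be the Hilbert $C_0(G^0)$-module of continuous sections vanishing at infinity of the continuous field $\{L^2(G^u,\lambda^u)\}_{u\in G^0}$ whose continuous sections are generated by $C_c(G)$, with $\langle\xi,\eta\rangle(u)=(\xi(u),\eta(u))$, and let $\mathfrak L(E^2)$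 be the algebra of its adjointable operators. For every $F\in C_c(G)$ the right convolution operator $f\mapsto f*F$ on $C_c(G)\subset E^2$ extends uniquely to a bounded operator $R_F$ on $E^2$; moreover $R_F\in\mathfrak L(E^2)$ and $\|R_F\|\le\|F\|_I$. The map $F\mapsto R_F$ is a $*$-antirepresentation of $C_c(G)$: it is linear, $R_{F*K}=R_KR_F$ and $R_{F^*}=R_F^*$. It satisfies $\|R_F\|=\|F\|_{red}$, and the closure $B$ of its image in $\mathfrak L(E^2)$ is a $*$-subalgebra canonically isomorphic to $C^*_{red}(G)$: there is an isometric $*$-isomorphism $C^*_{red}(G)\to B$ taking $F^\vee$ to $R_F$ for all $F\in C_c(G)$, and an isometric $*$-anti-isomorphism $C^*_{red}(G)\to B$ taking $F$ to $R_F$ for all $F\in C_c(G)$. -/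

import Mathlib

open MeasureTheory Filter Topology
open scoped ENNReal ComplexOrder CompactlySupported ZeroAtInfty

set_option linter.unusedSectionVars false

namespace KernelOperator

variable {α : Type*} [MeasurableSpace α] {μ : Measure α} [SFinite μ]

lemma lintegral_sq_le {κ : α → α → ℝ≥0∞} (hκ : AEMeasurable (Function.uncurry κ) (μ.prod μ))
    {C : ℝ≥0∞} (h1 : ∀ᵐ x ∂μ, ∫⁻ w, κ x w ∂μ ≤ C) (h2 : ∀ᵐ w ∂μ, ∫⁻ x, κ x w ∂μ ≤ C)
    {f : α → ℝ≥0∞} (hf : AEMeasurable f μ) :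
    ∫⁻ x, (∫⁻ w, κ x w * f w ∂μ) ^ (2 : ℝ) ∂μ ≤ C ^ (2 : ℝ) * ∫⁻ w, f w ^ (2 : ℝ) ∂μ := by
  have hrow : ∀ᵐ x ∂μ, AEMeasurable (κ x) μ := by
    filter_upwards [hκ.aestronglyMeasurable.prodMk_left] with x hx
    exact hx.aemeasurable
  have key : ∀ᵐ x ∂μ, (∫⁻ w, κ x w * f w ∂μ) ^ (2 : ℝ) ≤
      C * ∫⁻ w, κ x w * f w ^ (2 : ℝ) ∂μ := by
    filter_upwards [hrow, h1] with x hx hx1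
    have hh := ENNReal.lintegral_mul_le_Lp_mul_Lq μ (p := 2) (q := 2)
      (by constructor <;> norm_num) (f := fun w => κ x w ^ (1 / 2 : ℝ))
      (g := fun w => κ x w ^ (1 / 2 : ℝ) * f w) (hx.pow_const _) ((hx.pow_const _).mul hf)
    have e1 : ∀ a b : ℝ≥0∞, a ^ (1 / 2 : ℝ) * (a ^ (1 / 2 : ℝ) * b) = a * b := by
      intro a b
      rw [← mul_assoc, ← ENNReal.rpow_add_of_nonneg _ _ (by norm_num) (by norm_num)]
      norm_num
    have e2 : ∀ a : ℝ≥0∞, (a ^ (1 / 2 : ℝ)) ^ (2 : ℝ) = a := by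
      intro a
      rw [← ENNReal.rpow_mul]; norm_num
    simp only [Pi.mul_apply, e1, ENNReal.mul_rpow_of_nonneg _ _ (zero_le_two (α := ℝ)), e2] at hh
    calc (∫⁻ w, κ x w * f w ∂μ) ^ (2 : ℝ) ≤ _ := ENNReal.rpow_le_rpow hh zero_le_two
      _ = (∫⁻ w, κ x w ∂μ) * ∫⁻ w, κ x w * f w ^ (2 : ℝ) ∂μ := by
        rw [ENNReal.mul_rpow_of_nonneg _ _ zero_le_two, e2, e2]
      _ ≤ _ := by gcongr
  have hm : AEMeasurable (Function.uncurry fun x w => κ x w * f w ^ (2 : ℝ)) (μ.prod μ) :=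
    hκ.mul ((hf.pow_const _).comp_quasiMeasurePreserving Measure.quasiMeasurePreserving_snd)
  calc _ ≤ ∫⁻ x, C * ∫⁻ w, κ x w * f w ^ (2 : ℝ) ∂μ ∂μ := lintegral_mono_ae key
    _ = C * ∫⁻ x, ∫⁻ w, κ x w * f w ^ (2 : ℝ) ∂μ ∂μ :=
      lintegral_const_mul'' _ hm.lintegral_prod_right'
    _ = C * ∫⁻ w, ∫⁻ x, κ x w * f w ^ (2 : ℝ) ∂μ ∂μ := by rw [lintegral_lintegral_swap hm]
    _ ≤ C * ∫⁻ w, C * f w ^ (2 : ℝ) ∂μ := by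
      refine mul_le_mul' le_rfl (lintegral_mono_ae ?_)
      have hcol : ∀ᵐ w ∂μ, AEMeasurable (fun x => κ x w) μ := by
        filter_upwards [hκ.prod_swap.aestronglyMeasurable.prodMk_left] with x hx
        exact hx.aemeasurable
      filter_upwards [h2, hcol] with w hw hc
      rw [lintegral_mul_const'' _ hc]
      gcongr
    _ = _ := by
      rw [lintegral_const_mul'' _ (hf.pow_const _), ← mul_assoc]
      congr 1
      rw [← sq]; norm_cast

/-- The hypotheses of Schur's test for an integral kernel, with bound `C`. -/
structure IsSchur (μ : Measure α) (k : α → α → ℂ) (C : ℝ≥0∞) : Prop where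
  aesm : AEStronglyMeasurable (Function.uncurry k) (μ.prod μ)
  row : ∀ᵐ x ∂μ, ∫⁻ w, ‖k x w‖ₑ ∂μ ≤ C
  col : ∀ᵐ w ∂μ, ∫⁻ x, ‖k x w‖ₑ ∂μ ≤ C

variable {k l m : α → α → ℂ} {C C' C'' : ℝ≥0∞}

lemma IsSchur.lintegral_le (hk : IsSchur μ k C) {f : α → ℝ≥0∞} (hf : AEMeasurable f μ) :
    ∫⁻ x, (∫⁻ w, ‖k x w‖ₑ * f w ∂μ) ^ (2 : ℝ) ∂μ ≤ C ^ (2 : ℝ) * ∫⁻ w, f w ^ (2 : ℝ) ∂μ :=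
  lintegral_sq_le hk.aesm.enorm hk.row hk.col hf

lemma lintegral_sq_lt_top {ξ : α → ℂ} (hξ : MemLp ξ 2 μ) : ∫⁻ w, ‖ξ w‖ₑ ^ (2 : ℝ) ∂μ < ∞ := by
  have := lintegral_rpow_enorm_lt_top_of_eLpNorm_lt_top (p := 2) (by simp) (by simp) hξ.2
  simpa using this

lemma IsSchur.ae_lt_top (hk : IsSchur μ k C) (hC : C < ∞) {f : α → ℝ≥0∞} (hf : AEMeasurable f μ)
    (hf2 : ∫⁻ w, f w ^ (2 : ℝ) ∂μ < ∞) : ∀ᵐ x ∂μ, ∫⁻ w, ‖k x w‖ₑ * f w ∂μ < ∞ := by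
  have hm : AEMeasurable (Function.uncurry fun x w => ‖k x w‖ₑ * f w) (μ.prod μ) :=
    hk.aesm.enorm.mul (hf.comp_quasiMeasurePreserving Measure.quasiMeasurePreserving_snd)
  have := ae_lt_top' (hm.lintegral_prod_right'.pow_const (2 : ℝ))
    ((hk.lintegral_le hf).trans_lt (ENNReal.mul_lt_top (by simp [hC]) hf2)).ne
  filter_upwards [this] with x hx
  by_contra hne
  rw [not_lt, top_le_iff] at hne
  simp only [Function.uncurry_apply_pair, hne] at hx
  simp at hx

lemma IsSchur.aesm_mul (hk : IsSchur μ k C) {ξ : α → ℂ} (hξ : AEStronglyMeasurable ξ μ) :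
    AEStronglyMeasurable (Function.uncurry fun x w => k x w * ξ w) (μ.prod μ) :=
  hk.aesm.mul (hξ.comp_snd)

lemma IsSchur.integrable (hk : IsSchur μ k C) (hC : C < ∞) {ξ : α → ℂ} (hξ : MemLp ξ 2 μ) :
    ∀ᵐ x ∂μ, Integrable (fun w => k x w * ξ w) μ := by
  filter_upwards [hk.ae_lt_top hC hξ.1.enorm (lintegral_sq_lt_top hξ),
    (hk.aesm_mul hξ.1).prodMk_left] with x hx hx2
  refine ⟨hx2, ?_⟩
  rw [HasFiniteIntegral]
  simpa [enorm_mul] using hx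

lemma IsSchur.eLpNorm_le (hk : IsSchur μ k C) {ξ : α → ℂ} (hξ : MemLp ξ 2 μ) :
    eLpNorm (fun x => ∫ w, k x w * ξ w ∂μ) 2 μ ≤ C * eLpNorm ξ 2 μ := by
  rw [eLpNorm_eq_lintegral_rpow_enorm_toReal (by simp) (by simp),
    eLpNorm_eq_lintegral_rpow_enorm_toReal (by simp) (by simp)]
  simp only [ENNReal.toReal_ofNat]
  have e2 : C = (C ^ (2 : ℝ)) ^ (1 / 2 : ℝ) := by
    rw [← ENNReal.rpow_mul]; norm_num
  rw [e2, ← ENNReal.mul_rpow_of_nonneg _ _ (by norm_num)]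
  gcongr
  refine (lintegral_mono fun x => ?_).trans (hk.lintegral_le hξ.1.enorm)
  gcongr
  refine (enorm_integral_le_lintegral_enorm _).trans ?_
  simp [enorm_mul]

lemma IsSchur.memLp (hk : IsSchur μ k C) (hC : C < ∞) {ξ : α → ℂ} (hξ : MemLp ξ 2 μ) :
    MemLp (fun x => ∫ w, k x w * ξ w ∂μ) 2 μ :=
  ⟨(hk.aesm_mul hξ.1).integral_prod_right',
    (hk.eLpNorm_le hξ).trans_lt (ENNReal.mul_lt_top hC hξ.2)⟩

/-- The integral operator of a kernel satisfying the Schur test. -/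
noncomputable def op (hk : IsSchur μ k C) (hC : C < ∞) : Lp ℂ 2 μ →L[ℂ] Lp ℂ 2 μ :=
  LinearMap.mkContinuous
    { toFun := fun ξ => (hk.memLp hC (Lp.memLp ξ)).toLp
      map_add' := fun ξ η => by
        rw [← MemLp.toLp_add]
        refine MemLp.toLp_congr _ _ ?_
        filter_upwards [hk.integrable hC (Lp.memLp ξ), hk.integrable hC (Lp.memLp η)] with x h1 h2
        rw [Pi.add_apply, ← integral_add h1 h2]
        refine integral_congr_ae ?_
        filter_upwards [Lp.coeFn_add ξ η] with w hw
        rw [hw, Pi.add_apply, mul_add]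
      map_smul' := fun c ξ => by
        rw [RingHom.id_apply, ← MemLp.toLp_const_smul]
        refine MemLp.toLp_congr _ _ (Eventually.of_forall fun x => ?_)
        rw [Pi.smul_apply, ← integral_smul]
        refine integral_congr_ae ?_
        filter_upwards [Lp.coeFn_smul c ξ] with w hw
        rw [hw, Pi.smul_apply, smul_eq_mul, smul_eq_mul]; ring }
    C.toReal (fun ξ => by
      simp only [LinearMap.coe_mk, AddHom.coe_mk]
      rw [Lp.norm_toLp, Lp.norm_def, ← ENNReal.toReal_mul]
      exact ENNReal.toReal_mono (ENNReal.mul_lt_top hC (Lp.memLp ξ).2).ne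
        (hk.eLpNorm_le (Lp.memLp ξ)))

lemma op_coeFn (hk : IsSchur μ k C) (hC : C < ∞) (ξ : Lp ℂ 2 μ) :
    op hk hC ξ =ᵐ[μ] fun x => ∫ w, k x w * ξ w ∂μ :=
  MemLp.coeFn_toLp (hk.memLp hC (Lp.memLp ξ))

lemma norm_op_le (hk : IsSchur μ k C) (hC : C < ∞) : ‖op hk hC‖ ≤ C.toReal :=
  LinearMap.mkContinuous_norm_le _ ENNReal.toReal_nonneg _

lemma op_add (hk : IsSchur μ k C) (hC : C < ∞) (hl : IsSchur μ l C') (hC' : C' < ∞)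
    (hm : IsSchur μ m C'') (hC'' : C'' < ∞) (h : ∀ x w, m x w = k x w + l x w) :
    op hm hC'' = op hk hC + op hl hC' := by
  ext1 ξ
  refine Lp.ext ?_
  rw [_root_.add_apply]
  filter_upwards [op_coeFn hm hC'' ξ, op_coeFn hk hC ξ, op_coeFn hl hC' ξ,
    Lp.coeFn_add (op hk hC ξ) (op hl hC' ξ), hk.integrable hC (Lp.memLp ξ),
    hl.integrable hC' (Lp.memLp ξ)] with x h1 h2 h3 h4 i1 i2
  rw [h1, h4, Pi.add_apply, h2, h3, ← integral_add i1 i2]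
  simp only [h, add_mul]

lemma op_smul (hk : IsSchur μ k C) (hC : C < ∞)
    (hm : IsSchur μ m C'') (hC'' : C'' < ∞) (c : ℂ) (h : ∀ x w, m x w = c * k x w) :
    op hm hC'' = c • op hk hC := by
  ext1 ξ
  refine Lp.ext ?_
  rw [_root_.smul_apply]
  filter_upwards [op_coeFn hm hC'' ξ, op_coeFn hk hC ξ, Lp.coeFn_smul c (op hk hC ξ)]
    with x h1 h2 h4
  rw [h1, h4, Pi.smul_apply, h2, ← integral_smul]
  simp only [h, smul_eq_mul, mul_assoc]

lemma op_mul (hk : IsSchur μ k C) (hC : C < ∞) (hl : IsSchur μ l C') (hC' : C' < ∞)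
    (hm : IsSchur μ m C'') (hC'' : C'' < ∞)
    (h : ∀ᵐ x ∂μ, ∀ᵐ w ∂μ, m x w = ∫ y, k x y * l y w ∂μ) :
    op hm hC'' = op hk hC * op hl hC' := by
  ext1 ξ
  refine Lp.ext ?_
  rw [mul_apply_eq_comp]
  have hf : AEMeasurable (fun y => ∫⁻ w, ‖l y w‖ₑ * ‖ξ w‖ₑ ∂μ) μ :=
    (hl.aesm.enorm.mul ((Lp.aestronglyMeasurable ξ).comp_snd).enorm).lintegral_prod_right'
  have hf2 := (hl.lintegral_le (Lp.aestronglyMeasurable ξ).enorm).trans_lt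
    (ENNReal.mul_lt_top (by simp [hC']) (lintegral_sq_lt_top (Lp.memLp ξ)))
  filter_upwards [op_coeFn hm hC'' ξ, op_coeFn hk hC (op hl hC' ξ), h,
    hk.ae_lt_top hC hf hf2, hk.aesm.prodMk_left] with x h1 h2 h3 h4 h5
  rw [h1, h2]
  have hmeas : AEStronglyMeasurable (Function.uncurry fun y w => k x y * (l y w * ξ w))
      (μ.prod μ) := h5.comp_fst.mul (hl.aesm_mul (Lp.aestronglyMeasurable ξ))
  have hint : Integrable (Function.uncurry fun y w => k x y * (l y w * ξ w)) (μ.prod μ) := by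
    refine ⟨hmeas, ?_⟩
    rw [HasFiniteIntegral, lintegral_prod _ hmeas.enorm]
    refine lt_of_eq_of_lt (lintegral_congr_ae ?_) h4
    filter_upwards [(hl.aesm_mul (Lp.aestronglyMeasurable ξ)).prodMk_left] with y hy
    simp only [Function.uncurry_apply_pair, enorm_mul]
    rw [lintegral_const_mul'' _ (by simpa [enorm_mul] using hy.enorm)]
  calc ∫ w, m x w * ξ w ∂μ = ∫ w, ∫ y, k x y * (l y w * ξ w) ∂μ ∂μ := by
        refine integral_congr_ae ?_
        filter_upwards [h3] with w hw
        rw [hw, ← integral_mul_const]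
        simp only [mul_assoc]
    _ = ∫ y, ∫ w, k x y * (l y w * ξ w) ∂μ ∂μ := (integral_integral_swap hint).symm
    _ = ∫ y, k x y * (op hl hC' ξ) y ∂μ := by
        refine integral_congr_ae ?_
        filter_upwards [op_coeFn hl hC' ξ] with y hy
        rw [hy, ← integral_const_mul]

lemma op_adjoint (hk : IsSchur μ k C) (hC : C < ∞) (hm : IsSchur μ m C'') (hC'' : C'' < ∞)
    (h : ∀ᵐ x ∂μ, ∀ᵐ w ∂μ, m x w = star (k w x)) : op hm hC'' = star (op hk hC) := by
  rw [ContinuousLinearMap.star_eq_adjoint, ContinuousLinearMap.eq_adjoint_iff]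
  intro ξ η
  rw [L2.inner_def, L2.inner_def]
  have hmeas : AEStronglyMeasurable (Function.uncurry fun x w => star (ξ x) * (k x w * η w))
      (μ.prod μ) := ((continuous_star.comp_aestronglyMeasurable
        (Lp.aestronglyMeasurable ξ)).comp_fst).mul (hk.aesm_mul (Lp.aestronglyMeasurable η))
  have hf : AEMeasurable (fun y => ∫⁻ w, ‖k y w‖ₑ * ‖η w‖ₑ ∂μ) μ :=
    (hk.aesm.enorm.mul ((Lp.aestronglyMeasurable η).comp_snd).enorm).lintegral_prod_right'
  have hf2 := (hk.lintegral_le (Lp.aestronglyMeasurable η).enorm).trans_lt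
    (ENNReal.mul_lt_top (by simp [hC]) (lintegral_sq_lt_top (Lp.memLp η)))
  have hint : Integrable (Function.uncurry fun x w => star (ξ x) * (k x w * η w))
      (μ.prod μ) := by
    refine ⟨hmeas, ?_⟩
    rw [HasFiniteIntegral, lintegral_prod _ hmeas.enorm]
    have hh := ENNReal.lintegral_mul_le_Lp_mul_Lq μ (p := 2) (q := 2)
      (by constructor <;> norm_num) (Lp.aestronglyMeasurable ξ).enorm hf
    refine lt_of_le_of_lt (le_trans (lintegral_mono_ae ?_) hh) (ENNReal.mul_lt_top
      (ENNReal.rpow_lt_top_of_nonneg (by norm_num) (lintegral_sq_lt_top (Lp.memLp ξ)).ne)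
      (ENNReal.rpow_lt_top_of_nonneg (by norm_num) hf2.ne))
    filter_upwards [(hk.aesm_mul (Lp.aestronglyMeasurable η)).prodMk_left] with y hy
    simp only [Function.uncurry_apply_pair, enorm_mul, Pi.mul_apply]
    rw [lintegral_const_mul'' _ (by simpa [enorm_mul] using hy.enorm)]
    simp [enorm_eq_nnnorm]
  calc ∫ w, inner ℂ (op hm hC'' ξ w) (η w) ∂μ
      = ∫ w, ∫ x, star (ξ x) * (k x w * η w) ∂μ ∂μ := by
        refine integral_congr_ae ?_
        filter_upwards [op_coeFn hm hC'' ξ, h] with w hw hw2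
        rw [hw, RCLike.inner_apply, ← integral_conj, ← integral_const_mul]
        refine integral_congr_ae ?_
        filter_upwards [hw2] with x hx
        rw [hx]; simp; ring
    _ = ∫ x, ∫ w, star (ξ x) * (k x w * η w) ∂μ ∂μ := (integral_integral_swap hint).symm
    _ = ∫ x, inner ℂ (ξ x) (op hk hC η x) ∂μ := by
        refine integral_congr_ae ?_
        filter_upwards [op_coeFn hk hC η] with x hx
        rw [hx, RCLike.inner_apply, integral_const_mul, mul_comm]; rfl

end KernelOperator

/-- The pointwise order on `C₀(X)`. -/
noncomputable instance instPartialOrderC0 {X : Type*} [TopologicalSpace X] : PartialOrder C₀(X, ℂ) :=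
  PartialOrder.lift (fun f : C₀(X, ℂ) => (f : X → ℂ)) DFunLike.coe_injective

section Adjointable

variable (A E : Type*) [NonUnitalRing A] [StarRing A] [Module ℂ A] [StarModule ℂ A]
  [PartialOrder A] [Norm A] [NormedAddCommGroup E] [NormedSpace ℂ E] [SMul A E] [CStarModule A E]

/-- The bounded operators on a Hilbert `A`-module `E` that have an adjoint. -/
def adjointableSubalgebra : Subalgebra ℂ (E →L[ℂ] E) where
  carrier := {T | ∃ S : E →L[ℂ] E, ∀ x y, inner A (T x) y = inner A x (S y)}
  mul_mem' := by
    rintro T T' ⟨S, hS⟩ ⟨S', hS'⟩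
    exact ⟨S' * S, fun x y => by
      rw [mul_apply_eq_comp, mul_apply_eq_comp, hS, hS']⟩
  add_mem' := by
    rintro T T' ⟨S, hS⟩ ⟨S', hS'⟩
    exact ⟨S + S', fun x y => by
      rw [_root_.add_apply, _root_.add_apply, CStarModule.inner_add_left,
        CStarModule.inner_add_right, hS, hS']⟩
  algebraMap_mem' c := ⟨star c • 1, fun x y => by
    rw [Algebra.algebraMap_eq_smul_one, _root_.smul_apply, _root_.smul_apply,
      CStarModule.inner_smul_left_complex, CStarModule.inner_smul_right_complex]
    rfl⟩

/-- The normed `*`-algebra `𝔏(E)` of adjointable operators on a Hilbert `A`-module `E`, with the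
operator norm. -/
def Adjointable : Type _ := adjointableSubalgebra A E

noncomputable instance : NormedRing (Adjointable A E) :=
  inferInstanceAs (NormedRing (adjointableSubalgebra A E))

noncomputable instance : NormedAlgebra ℂ (Adjointable A E) :=
  inferInstanceAs (NormedAlgebra ℂ (adjointableSubalgebra A E))

/-- The bounded operator underlying an adjointable operator. -/
def Adjointable.toCLM {A E : Type*} [NonUnitalRing A] [StarRing A] [Module ℂ A] [StarModule ℂ A]
    [PartialOrder A] [Norm A] [NormedAddCommGroup E] [NormedSpace ℂ E] [SMul A E]
    [CStarModule A E] (T : Adjointable A E) : E →L[ℂ] E := T.1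

variable {A E}

lemma CStarModule.ext_inner {y z : E} (h : ∀ x : E, inner A x y = inner A x z) : y = z := by
  rw [← sub_eq_zero, ← CStarModule.inner_self (A := A), CStarModule.inner_sub_right, h, sub_self]

/-- The adjoint of an adjointable operator. -/
noncomputable instance : Star (Adjointable A E) where
  star T := ⟨T.2.choose, T.1, fun x y => by
    rw [← CStarModule.star_inner y, ← T.2.choose_spec, CStarModule.star_inner]⟩

lemma Adjointable.inner_star (T : Adjointable A E) (x y : E) :
    inner A (T.1 x) y = inner A x ((star T).1 y) :=
  T.2.choose_spec x y

lemma Adjointable.star_eq {T S : Adjointable A E}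
    (h : ∀ x y, inner A (T.1 x) y = inner A x (S.1 y)) : star T = S := by
  refine Subtype.ext (ContinuousLinearMap.ext fun y => ?_)
  refine CStarModule.ext_inner (A := A) fun x => ?_
  rw [← h, Adjointable.inner_star]

noncomputable instance : StarRing (Adjointable A E) where
  star_involutive T := Adjointable.star_eq fun x y => by
    rw [← CStarModule.star_inner y, ← Adjointable.inner_star, CStarModule.star_inner]
  star_mul T S := Adjointable.star_eq fun x y => by
    change inner A (T.1 (S.1 x)) y = inner A x ((star S).1 ((star T).1 y))
    rw [Adjointable.inner_star, Adjointable.inner_star]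
  star_add T S := Adjointable.star_eq fun x y => by
    change inner A (T.1 x + S.1 x) y = inner A x ((star T).1 y + (star S).1 y)
    rw [CStarModule.inner_add_left, CStarModule.inner_add_right, Adjointable.inner_star,
      Adjointable.inner_star]

instance : StarModule ℂ (Adjointable A E) where
  star_smul c T := Adjointable.star_eq fun x y => by
    change inner A (c • T.1 x) y = inner A x (star c • (star T).1 y)
    rw [CStarModule.inner_smul_left_complex, CStarModule.inner_smul_right_complex,
      Adjointable.inner_star]

end Adjointable

/-- A topological groupoid with arrow space `G` and unit space `G₀`: the range and source maps
`r`, `s`, the inclusion of units, inversion, and the product. The product `mul x y` is a total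
function whose value carries meaning only when `s x = r y`; its laws and its continuity are
required only on the set of composable pairs. -/
class TopologicalGroupoid (G : Type*) (G₀ : outParam Type*)
    [TopologicalSpace G] [TopologicalSpace G₀] where
  /-- the range map -/
  r : G → G₀
  /-- the source map -/
  s : G → G₀
  /-- the inclusion of the units -/
  unit : G₀ → G
  /-- inversion -/
  inv : G → G
  /-- the product of a composable pair -/
  mul : G → G → G
  r_unit : ∀ u, r (unit u) = u
  s_unit : ∀ u, s (unit u) = u
  r_inv : ∀ x, r (inv x) = s x
  s_inv : ∀ x, s (inv x) = r x
  r_mul : ∀ x y, s x = r y → r (mul x y) = r x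
  s_mul : ∀ x y, s x = r y → s (mul x y) = s y
  mul_assoc : ∀ x y z, s x = r y → s y = r z → mul (mul x y) z = mul x (mul y z)
  unit_mul : ∀ x, mul (unit (r x)) x = x
  mul_unit : ∀ x, mul x (unit (s x)) = x
  inv_mul : ∀ x, mul (inv x) x = unit (s x)
  mul_inv : ∀ x, mul x (inv x) = unit (r x)
  continuous_r : Continuous r
  continuous_s : Continuous s
  continuous_unit : Continuous unit
  continuous_inv : Continuous inv
  continuousOn_mul : ContinuousOn (fun p : G × G => mul p.1 p.2) {p | s p.1 = r p.2}

namespace TopologicalGroupoid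

/-- A left Haar system on `G`. The measure `lam u` on the fiber `G^u = r⁻¹(u)` is given as a
measure on `G` that vanishes off `G^u`. On a second countable locally compact Hausdorff space,
Borel measures that are finite on compact sets are regular. -/
structure HaarSystem (G : Type*) {G₀ : Type*} [TopologicalSpace G] [TopologicalSpace G₀]
    [TopologicalGroupoid G G₀] [MeasurableSpace G] where
  /-- the measure `λ^u` -/
  lam : G₀ → Measure G
  lam_lt_top : ∀ u (K : Set G), IsCompact K → lam u K < ∞
  lam_compl : ∀ u, lam u {x | r x ≠ u} = 0
  lam_pos : ∀ u (U : Set G), IsOpen U → (∃ x ∈ U, r x = u) → 0 < lam u U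
  continuous_integral : ∀ f : C_c(G, ℂ), Continuous fun u => ∫ t, f t ∂(lam u)
  map_mul_left : ∀ x, (lam (s x)).map (mul x) = lam (r x)

section Algebra

variable {G G₀ : Type*} [TopologicalSpace G] [TopologicalSpace G₀] [TopologicalGroupoid G G₀]

lemma inv_mul_cancel_left (x y : G) (h : s x = r y) : mul (inv x) (mul x y) = y := by
  rw [← mul_assoc _ _ _ (s_inv x) h, inv_mul, h, unit_mul]

lemma mul_inv_cancel_left (x y : G) (h : r x = r y) : mul x (mul (inv x) y) = y := by
  rw [← mul_assoc _ _ _ (r_inv x).symm (by rw [s_inv, h]), mul_inv, h, unit_mul]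

lemma inv_inv (x : G) : inv (inv x) = x := by
  have h : mul (inv (inv x)) (mul (inv x) x) = x :=
    inv_mul_cancel_left (inv x) x (s_inv x)
  rw [inv_mul] at h
  have h2 := mul_unit (inv (inv x))
  rw [s_inv, r_inv, h] at h2
  exact h2.symm

lemma inv_mul_rev (x y : G) (h : s x = r y) : inv (mul x y) = mul (inv y) (inv x) := by
  have h1 : mul (mul x y) (mul (inv y) (inv x)) = unit (r x) := by
    rw [mul_assoc x y _ h (by rw [r_mul _ _ (by rw [s_inv, r_inv, h]), r_inv]),
      mul_inv_cancel_left _ _ (by rw [r_inv, h]), mul_inv]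
  have h2 := inv_mul_cancel_left (mul x y) (mul (inv y) (inv x))
    (by rw [s_mul _ _ h, r_mul _ _ (by rw [s_inv, r_inv, h]), r_inv])
  rw [← h2, h1]
  have h3 := mul_unit (inv (mul x y))
  rwa [s_inv, r_mul _ _ h, eq_comm] at h3

variable (G) in
lemma t2_units [T2Space G] : T2Space G₀ :=
  T2Space.of_injective_continuous (f := (unit : G₀ → G))
    (fun u v h => by rw [← r_unit (G := G) u, h, r_unit]) continuous_unit

lemma isClosed_fiber [T2Space G] (u : G₀) : IsClosed {x : G | r x = u} := by
  have := t2_units G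
  exact isClosed_eq continuous_r continuous_const

end Algebra

namespace HaarSystem

variable {G G₀ : Type*} [TopologicalSpace G] [TopologicalSpace G₀] [TopologicalGroupoid G G₀]
  [MeasurableSpace G] (H : HaarSystem G)

instance (u : G₀) : IsFiniteMeasureOnCompacts (H.lam u) := ⟨fun _ hK => H.lam_lt_top u _ hK⟩

lemma ae_r (u : G₀) : ∀ᵐ x ∂(H.lam u), r x = u := H.lam_compl u


lemma integrable_cc (u : G₀) [OpensMeasurableSpace G] (f : C_c(G, ℂ)) :
    Integrable f (H.lam u) :=
  f.continuous.integrable_of_hasCompactSupport f.hasCompactSupport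

lemma continuous_integral_norm (f : C_c(G, ℂ)) : Continuous fun u => ∫ t, ‖f t‖ ∂(H.lam u) := by
  let g : C_c(G, ℂ) := ⟨⟨fun t => ((‖f t‖ : ℝ) : ℂ), by fun_prop⟩, by
    refine f.hasCompactSupport.mono ?_
    intro x hx h
    exact hx (by simp [h])⟩
  have h := Complex.continuous_re.comp (H.continuous_integral g)
  refine h.congr fun u => ?_
  simp only [Function.comp]
  change (∫ t, ((‖f t‖ : ℝ) : ℂ) ∂(H.lam u)).re = _
  rw [integral_complex_ofReal, Complex.ofReal_re]

variable [T2Space G] [LocallyCompactSpace G] [SecondCountableTopology G] [BorelSpace G]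

lemma continuous_integral_prod (χ : C_c(G, ℂ)) (φ : C(G × G, ℂ)) :
    Continuous fun p : G₀ × G => ∫ t, χ t * φ (t, p.2) ∂(H.lam p.1) := by
  rw [continuous_iff_continuousAt]
  rintro ⟨u₀, x₀⟩
  let cut (x : G) : C_c(G, ℂ) := ⟨⟨fun t => χ t * φ (t, x), by fun_prop⟩,
    χ.hasCompactSupport.mul_right⟩
  have hint (u : G₀) (x : G) : Integrable (fun t => χ t * φ (t, x)) (H.lam u) :=
    H.integrable_cc u (cut x)
  have h1 : Tendsto (fun p : G₀ × G => ∫ t, χ t * φ (t, x₀) ∂(H.lam p.1)) (𝓝 (u₀, x₀))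
      (𝓝 (∫ t, χ t * φ (t, x₀) ∂(H.lam u₀))) :=
    ((H.continuous_integral (cut x₀)).comp continuous_fst).continuousAt
  have h2 : Tendsto (fun p : G₀ × G => (∫ t, χ t * φ (t, p.2) ∂(H.lam p.1)) -
      ∫ t, χ t * φ (t, x₀) ∂(H.lam p.1)) (𝓝 (u₀, x₀)) (𝓝 0) := by
    rw [Metric.tendsto_nhds]
    intro ε hε
    set M := (∫ t, ‖χ t‖ ∂(H.lam u₀)) + 1 with hM
    have hM0 : 0 < M := by positivity
    have e1 : ∀ᶠ p : G₀ × G in 𝓝 (u₀, x₀), ∫ t, ‖χ t‖ ∂(H.lam p.1) < M :=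
      ((H.continuous_integral_norm χ).comp continuous_fst).continuousAt.eventually_lt
        continuousAt_const (by simp [hM])
    have e2 : ∀ᶠ x in 𝓝 x₀, ∀ t ∈ tsupport χ, ‖φ (t, x) - φ (t, x₀)‖ < ε / M := by
      refine χ.hasCompactSupport.isCompact.eventually_forall_of_forall_eventually
        (P := fun x t => ‖φ (t, x) - φ (t, x₀)‖ < ε / M) fun t _ => ?_
      have hc : Continuous fun z : G × G => ‖φ (z.2, z.1) - φ (z.2, x₀)‖ := by fun_prop
      exact hc.continuousAt.eventually_lt continuousAt_const (by simpa using by positivity)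
    have e2' : ∀ᶠ p : G₀ × G in 𝓝 (u₀, x₀), ∀ t ∈ tsupport χ,
        ‖φ (t, p.2) - φ (t, x₀)‖ < ε / M :=
      (continuous_snd.tendsto (u₀, x₀)).eventually e2
    filter_upwards [e1, e2'] with p hp1 hp2
    rw [dist_zero_right, ← integral_sub (hint _ _) (hint _ _)]
    calc ‖∫ t, (χ t * φ (t, p.2) - χ t * φ (t, x₀)) ∂(H.lam p.1)‖
        ≤ ∫ t, ‖χ t‖ * (ε / M) ∂(H.lam p.1) := by
          refine norm_integral_le_of_norm_le ((H.integrable_cc _ χ).norm.mul_const _) ?_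
          refine Eventually.of_forall fun t => ?_
          rw [← mul_sub, norm_mul]
          by_cases ht : t ∈ tsupport χ
          · exact mul_le_mul_of_nonneg_left (hp2 t ht).le (norm_nonneg _)
          · simp [image_eq_zero_of_notMem_tsupport ht]
      _ = (∫ t, ‖χ t‖ ∂(H.lam p.1)) * (ε / M) := integral_mul_const _ _
      _ < M * (ε / M) := by gcongr
      _ = ε := by field_simp
  have h3 := h2.add h1
  simpa [ContinuousAt] using h3

/-- A function `f(t) g(t⁻¹ x)`, defined for `r t = r x`, extends continuously. -/
lemma exists_extension (g : C_c(G, ℂ)) : ∃ φ : C(G × G, ℂ), ∀ t x, r t = r x →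
    φ (t, x) = g (mul (inv t) x) := by
  have := t2_units G
  let Z : Set (G × G) := {p | r p.1 = r p.2}
  have hZ : IsClosed Z :=
    isClosed_eq (continuous_r.comp continuous_fst) (continuous_r.comp continuous_snd)
  have hc : ContinuousOn (fun p : G × G => g (mul (inv p.1) p.2)) Z := by
    refine g.continuous.comp_continuousOn ?_
    refine continuousOn_mul.comp (f := fun p : G × G => (inv p.1, p.2)) ?_ ?_
    · exact ((continuous_inv.comp continuous_fst).prodMk continuous_snd).continuousOn
    · intro p hp
      simpa [s_inv, Z] using hp
  obtain ⟨φ, hφ⟩ := ContinuousMap.exists_restrict_eq hZ ⟨_, hc.domRestrict⟩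
  refine ⟨φ, fun t x h => ?_⟩
  have := congrArg (fun k => k ⟨(t, x), h⟩) hφ
  simpa using this

lemma continuous_conv (f g : C_c(G, ℂ)) :
    Continuous fun x => ∫ t, f t * g (mul (inv t) x) ∂(H.lam (r x)) := by
  obtain ⟨φ, hφ⟩ := exists_extension g
  have h := (H.continuous_integral_prod f φ).comp
    ((continuous_r (G := G)).prodMk continuous_id)
  refine h.congr fun x => ?_
  refine integral_congr_ae ?_
  filter_upwards [H.ae_r (r x)] with t ht
  simp [hφ t x ht]

lemma hasCompactSupport_conv (f g : C_c(G, ℂ)) :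
    HasCompactSupport fun x => ∫ t, f t * g (mul (inv t) x) ∂(H.lam (r x)) := by
  have := t2_units G
  let K : Set (G × G) := (tsupport f ×ˢ tsupport g) ∩ {p | s p.1 = r p.2}
  have hK : IsCompact K :=
    (f.hasCompactSupport.isCompact.prod g.hasCompactSupport.isCompact).inter_right
      (isClosed_eq (continuous_s.comp continuous_fst) (continuous_r.comp continuous_snd))
  refine HasCompactSupport.intro
    (hK.image_of_continuousOn (continuousOn_mul.mono Set.inter_subset_right)) fun x hx => ?_
  refine integral_eq_zero_of_ae ?_
  filter_upwards [H.ae_r (r x)] with t ht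
  by_contra hne
  refine hx ⟨(t, mul (inv t) x), ⟨⟨subset_tsupport _ fun h => hne (by simp [h]),
    subset_tsupport _ fun h => hne (by simp [h])⟩, ?_⟩, mul_inv_cancel_left _ _ ht⟩
  simp [r_mul (inv t) x (by rw [s_inv, ht]), r_inv]

/-- The convolution `f * g (x) = ∫ f(t) g(t⁻¹ x) dλ^{r(x)}(t)` on `C_c(G)`. -/
noncomputable def conv (f g : C_c(G, ℂ)) : C_c(G, ℂ) where
  toFun x := ∫ t, f t * g (mul (inv t) x) ∂(H.lam (r x))
  continuous_toFun := H.continuous_conv f g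
  hasCompactSupport' := H.hasCompactSupport_conv f g

/-- The involution `F*(x) = conj (F (x⁻¹))` on `C_c(G)`. -/
noncomputable def invol (F : C_c(G, ℂ)) : C_c(G, ℂ) where
  toFun x := star (F (inv x))
  continuous_toFun := continuous_star.comp (F.continuous.comp continuous_inv)
  hasCompactSupport' := by
    refine HasCompactSupport.intro (F.hasCompactSupport.isCompact.image continuous_inv) ?_
    intro x hx
    rw [image_eq_zero_of_notMem_tsupport fun h => hx ⟨_, h, inv_inv x⟩, star_zero]

/-- `F^∨(x) = F (x⁻¹)`. -/
noncomputable def check (F : C_c(G, ℂ)) : C_c(G, ℂ) where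
  toFun x := F (inv x)
  continuous_toFun := F.continuous.comp continuous_inv
  hasCompactSupport' := by
    refine HasCompactSupport.intro (F.hasCompactSupport.isCompact.image continuous_inv) ?_
    intro x hx
    rw [image_eq_zero_of_notMem_tsupport fun h => hx ⟨_, h, inv_inv x⟩]

/-- The measure `λ_u = (λ^u)⁻¹`, the image of `λ^u` under inversion. It lives on `G_u`. -/
noncomputable def lamInv (u : G₀) : Measure G := (H.lam u).map inv

lemma measurable_inv : Measurable (inv : G → G) := continuous_inv.measurable

instance (u : G₀) : IsFiniteMeasureOnCompacts (H.lamInv u) := ⟨fun K hK => by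
  rw [lamInv, Measure.map_apply measurable_inv hK.measurableSet]
  refine (measure_mono ?_).trans_lt (H.lam_lt_top u _ (hK.image continuous_inv))
  exact fun x hx => ⟨_, hx, inv_inv x⟩⟩

lemma isClosed_sfiber (u : G₀) : IsClosed {x : G | s x = u} := by
  have := t2_units G
  exact isClosed_eq continuous_s continuous_const

lemma ae_s (u : G₀) : ∀ᵐ x ∂(H.lamInv u), s x = u := by
  rw [lamInv, ae_map_iff measurable_inv.aemeasurable (isClosed_sfiber u).measurableSet]
  filter_upwards [H.ae_r u] with x hx
  rw [s_inv, hx]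

lemma aemeasurable_lam {Y : Type*} [TopologicalSpace Y] [MeasurableSpace Y] [BorelSpace Y]
    {f : G → Y} (u : G₀) (hf : ContinuousOn f {x | r x = u}) : AEMeasurable f (H.lam u) := by
  rw [← Measure.restrict_eq_self_of_ae_mem (H.ae_r u)]
  exact hf.aemeasurable (isClosed_fiber u).measurableSet

lemma aemeasurable_lamInv {Y : Type*} [TopologicalSpace Y] [MeasurableSpace Y] [BorelSpace Y]
    {f : G → Y} (u : G₀) (hf : ContinuousOn f {x | s x = u}) : AEMeasurable f (H.lamInv u) := by
  rw [← Measure.restrict_eq_self_of_ae_mem (H.ae_s u)]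
  exact hf.aemeasurable (isClosed_sfiber u).measurableSet

lemma continuousOn_mul_left (x : G) : ContinuousOn (mul x) {y : G | r y = s x} :=
  continuousOn_mul.comp (f := fun y : G => (x, y)) (by fun_prop) fun _ hy => hy.symm

lemma continuousOn_div (x : G) :
    ContinuousOn (fun t => mul (inv t) x) {t : G | r t = r x} :=
  continuousOn_mul.comp (f := fun t : G => (inv t, x))
    ((continuous_inv.prodMk continuous_const).continuousOn) fun t ht => by
      change s (inv t) = r x
      rw [s_inv]; exact ht

lemma continuousOn_mul_inv (x : G) :
    ContinuousOn (fun w => mul x (inv w)) {w : G | s w = s x} :=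
  continuousOn_mul.comp (f := fun t : G => (x, inv t))
    ((continuous_const.prodMk continuous_inv).continuousOn) fun t ht => by
      change s x = r (inv t)
      rw [r_inv]; exact Eq.symm ht

lemma continuousOn_mul_inv' (w : G) :
    ContinuousOn (fun x => mul x (inv w)) {x : G | s x = s w} :=
  continuousOn_mul.comp (f := fun t : G => (t, inv w))
    ((continuous_id.prodMk continuous_const).continuousOn) fun t ht => by
      change s t = r (inv w)
      rw [r_inv]; exact ht

lemma map_div (x : G) :
    (H.lam (r x)).map (fun t => mul (inv t) x) = H.lamInv (s x) := by
  have h1 : AEMeasurable (mul x) (H.lam (s x)) :=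
    H.aemeasurable_lam _ (continuousOn_mul_left x)
  rw [← H.map_mul_left x, AEMeasurable.map_map_of_aemeasurable
    (by rw [H.map_mul_left]; exact H.aemeasurable_lam _ (continuousOn_div x)) h1, lamInv]
  refine Measure.map_congr ?_
  filter_upwards [H.ae_r (s x)] with v hv
  have e : s (inv v) = r (inv x) := by rw [s_inv, r_inv, hv]
  rw [Function.comp, inv_mul_rev _ _ hv.symm, mul_assoc _ _ _ e (s_inv x), inv_mul, ← hv,
    ← s_inv, mul_unit]

lemma mul_inv_div (t x : G) (h : r t = r x) : mul x (inv (mul (inv t) x)) = t := by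
  rw [inv_mul_rev _ _ (by rw [s_inv, h]), inv_inv, mul_inv_cancel_left _ _ h.symm]

lemma lintegral_kernel (x : G) {g : G → ℝ≥0∞} (hg : Continuous g) :
    ∫⁻ w, g (mul x (inv w)) ∂(H.lamInv (s x)) = ∫⁻ t, g t ∂(H.lam (r x)) := by
  rw [← H.map_div x, lintegral_map']
  · refine lintegral_congr_ae ?_
    filter_upwards [H.ae_r (r x)] with t ht
    rw [mul_inv_div t x ht]
  · rw [H.map_div x]
    exact H.aemeasurable_lamInv _ (hg.comp_continuousOn (continuousOn_mul_inv x))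
  · exact H.aemeasurable_lam _ (continuousOn_div x)

lemma integral_kernel (x : G) (F : C_c(G, ℂ)) {ξ : G → ℂ}
    (hξ : AEStronglyMeasurable ξ (H.lamInv (s x))) :
    ∫ w, F (mul x (inv w)) * ξ w ∂(H.lamInv (s x)) =
      ∫ t, F t * ξ (mul (inv t) x) ∂(H.lam (r x)) := by
  have h1 : AEStronglyMeasurable (fun w => F (mul x (inv w)) * ξ w) (H.lamInv (s x)) :=
    (H.aemeasurable_lamInv _ (F.continuous.comp_continuousOn
      (continuousOn_mul_inv x))).aestronglyMeasurable.mul hξ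
  rw [← H.map_div x] at h1 ⊢
  rw [integral_map (H.aemeasurable_lam _ (continuousOn_div x)) h1]
  refine integral_congr_ae ?_
  filter_upwards [H.ae_r (r x)] with t ht
  rw [mul_inv_div t x ht]

/-- `‖F‖_{I,r} = sup_u ∫ |F| dλ^u`. -/
noncomputable def iNormR (F : C_c(G, ℂ)) : ℝ := ⨆ u : G₀, ∫ t, ‖F t‖ ∂(H.lam u)

/-- `‖F‖_{I,d} = sup_u ∫ |F| dλ_u`. -/
noncomputable def iNormD (F : C_c(G, ℂ)) : ℝ := ⨆ u : G₀, ∫ t, ‖F t‖ ∂(H.lamInv u)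

/-- The `I`-norm on `C_c(G)`. -/
noncomputable def iNorm (F : C_c(G, ℂ)) : ℝ := max (H.iNormR F) (H.iNormD F)

lemma bddAbove_iNormR (F : C_c(G, ℂ)) :
    BddAbove (Set.range fun u : G₀ => ∫ t, ‖F t‖ ∂(H.lam u)) := by
  have := t2_units G
  refine (H.continuous_integral_norm F).bddAbove_range_of_hasCompactSupport
    (HasCompactSupport.intro (F.hasCompactSupport.isCompact.image continuous_r) fun u hu => ?_)
  refine integral_eq_zero_of_ae ?_
  filter_upwards [H.ae_r u] with t ht
  rw [image_eq_zero_of_notMem_tsupport fun h => hu ⟨t, h, ht⟩]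
  simp

lemma integral_lamInv (F : C_c(G, ℂ)) (u : G₀) :
    ∫ t, ‖F t‖ ∂(H.lamInv u) = ∫ t, ‖check F t‖ ∂(H.lam u) := by
  rw [lamInv, integral_map measurable_inv.aemeasurable
    (f := fun t => ‖F t‖) F.continuous.norm.aestronglyMeasurable]
  rfl

lemma lintegral_le_iNorm (F : C_c(G, ℂ)) (u : G₀) :
    ∫⁻ t, ‖F t‖ₑ ∂(H.lam u) ≤ ENNReal.ofReal (H.iNorm F) := by
  rw [← ofReal_integral_norm_eq_lintegral_enorm (H.integrable_cc u F)]
  exact ENNReal.ofReal_le_ofReal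
    ((le_ciSup (H.bddAbove_iNormR F) u).trans (le_max_left _ _))

lemma lintegral_check_le_iNorm (F : C_c(G, ℂ)) (u : G₀) :
    ∫⁻ t, ‖check F t‖ₑ ∂(H.lam u) ≤ ENNReal.ofReal (H.iNorm F) := by
  rw [← ofReal_integral_norm_eq_lintegral_enorm (H.integrable_cc u (check F)),
    ← integral_lamInv]
  refine ENNReal.ofReal_le_ofReal (le_trans
    (le_ciSup (f := fun u => ∫ t, ‖F t‖ ∂(H.lamInv u)) ?_ u) (le_max_right _ _))
  simp only [integral_lamInv]
  exact H.bddAbove_iNormR (check F)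

lemma isSchur (F : C_c(G, ℂ)) (u : G₀) :
    KernelOperator.IsSchur (H.lamInv u) (fun x w => F (mul x (inv w)))
      (ENNReal.ofReal (H.iNorm F)) where
  aesm := by
    have hS : IsClosed {p : G × G | s p.1 = u ∧ s p.2 = u} :=
      ((isClosed_sfiber u).preimage continuous_fst).inter
        ((isClosed_sfiber u).preimage continuous_snd)
    have hae : ∀ᵐ p ∂((H.lamInv u).prod (H.lamInv u)), p ∈ {p : G × G | s p.1 = u ∧ s p.2 = u} :=
      (Measure.quasiMeasurePreserving_fst.ae (H.ae_s u)).and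
        (Measure.quasiMeasurePreserving_snd.ae (H.ae_s u))
    rw [← Measure.restrict_eq_self_of_ae_mem hae]
    refine ContinuousOn.aestronglyMeasurable ?_ hS.measurableSet
    refine F.continuous.comp_continuousOn (continuousOn_mul.comp
      (f := fun p : G × G => (p.1, inv p.2)) ?_ ?_)
    · exact (continuous_fst.prodMk (continuous_inv.comp continuous_snd)).continuousOn
    · rintro p ⟨h1, h2⟩
      change s p.1 = r (inv p.2)
      rw [r_inv, h1, h2]
  row := by
    filter_upwards [H.ae_s u] with x hx
    subst hx
    rw [H.lintegral_kernel x (g := fun t => ‖F t‖ₑ) F.continuous.enorm]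
    exact H.lintegral_le_iNorm F _
  col := by
    filter_upwards [H.ae_s u] with w hw
    subst hw
    refine le_trans (le_of_eq ?_) (H.lintegral_check_le_iNorm F (r w))
    rw [← H.lintegral_kernel w (g := fun t => ‖check F t‖ₑ) (check F).continuous.enorm]
    refine lintegral_congr_ae ?_
    filter_upwards [H.ae_s (s w)] with x hx
    change _ = ‖F (inv (mul w (inv x)))‖ₑ
    rw [inv_mul_rev _ _ (by rw [r_inv, hx]), inv_inv]

/-- The regular representation `π_u(F)` on `L²(G_u)`, as the integral operator with kernel
`F(x w⁻¹)` with respect to `λ_u`. By `regRepFiber_coeFn` it is given by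
`π_u(F) ξ (x) = ∫ F(t) ξ(t⁻¹ x) dλ^{r(x)}(t)`. -/
noncomputable def regRepFiber (F : C_c(G, ℂ)) (u : G₀) :
    Lp ℂ 2 (H.lamInv u) →L[ℂ] Lp ℂ 2 (H.lamInv u) :=
  KernelOperator.op (H.isSchur F u) ENNReal.ofReal_lt_top

lemma regRepFiber_coeFn (F : C_c(G, ℂ)) (u : G₀) (ξ : Lp ℂ 2 (H.lamInv u)) :
    H.regRepFiber F u ξ =ᵐ[H.lamInv u]
      fun x => ∫ t, F t * ξ (mul (inv t) x) ∂(H.lam (r x)) := by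
  filter_upwards [KernelOperator.op_coeFn (H.isSchur F u) ENNReal.ofReal_lt_top ξ, H.ae_s u]
    with x h1 h2
  subst h2
  rw [← H.integral_kernel x F (Lp.aestronglyMeasurable ξ)]
  exact h1

lemma norm_regRepFiber_le (F : C_c(G, ℂ)) (u : G₀) : ‖H.regRepFiber F u‖ ≤ max (H.iNorm F) 0 := by
  refine (KernelOperator.norm_op_le _ _).trans ?_
  rw [ENNReal.toReal_ofReal']

/-- The C*-algebra of bounded families of operators on the Hilbert spaces `L²(G_u)`. -/
def OpFamily : Type _ := lp (fun u : G₀ => Lp ℂ 2 (H.lamInv u) →L[ℂ] Lp ℂ 2 (H.lamInv u)) ∞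

noncomputable instance : NonUnitalCStarAlgebra H.OpFamily :=
  inferInstanceAs (NonUnitalCStarAlgebra (lp (fun u : G₀ => Lp ℂ 2 (H.lamInv u) →L[ℂ] Lp ℂ 2 (H.lamInv u)) ∞))

/-- The direct sum `⊕_u π_u(F)` of the regular representations. -/
noncomputable def regRep (F : C_c(G, ℂ)) : H.OpFamily :=
  ⟨fun u => H.regRepFiber F u, memℓp_infty ⟨max (H.iNorm F) 0, by
    rintro _ ⟨u, rfl⟩
    exact H.norm_regRepFiber_le F u⟩⟩

/-- `‖F‖_red = sup_u ‖π_u(F)‖`. -/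
noncomputable def redNorm (F : C_c(G, ℂ)) : ℝ := ⨆ u : G₀, ‖H.regRepFiber F u‖

lemma norm_regRep (F : C_c(G, ℂ)) : ‖H.regRep F‖ = H.redNorm F := lp.norm_eq_ciSup _

lemma regRep_add (F K : C_c(G, ℂ)) : H.regRep (F + K) = H.regRep F + H.regRep K := by
  refine Subtype.ext (funext fun u => ?_)
  exact KernelOperator.op_add (H.isSchur F u) ENNReal.ofReal_lt_top
    (H.isSchur K u) ENNReal.ofReal_lt_top
    (H.isSchur (F + K) u) ENNReal.ofReal_lt_top fun _ _ => rfl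

lemma regRep_smul (c : ℂ) (F : C_c(G, ℂ)) : H.regRep (c • F) = c • H.regRep F := by
  refine Subtype.ext (funext fun u => ?_)
  exact KernelOperator.op_smul (H.isSchur F u) ENNReal.ofReal_lt_top
    (H.isSchur (c • F) u) ENNReal.ofReal_lt_top c fun _ _ => rfl

lemma regRep_conv (F K : C_c(G, ℂ)) : H.regRep (H.conv F K) = H.regRep F * H.regRep K := by
  refine Subtype.ext (funext fun u => ?_)
  refine KernelOperator.op_mul (H.isSchur F u) ENNReal.ofReal_lt_top
    (H.isSchur K u) ENNReal.ofReal_lt_top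
    (H.isSchur (H.conv F K) u) ENNReal.ofReal_lt_top ?_
  filter_upwards [H.ae_s u] with x hx
  filter_upwards [H.ae_s u] with w hw
  subst hx
  have e : s x = r (inv w) := by rw [r_inv, hw]
  rw [H.integral_kernel x F (ξ := fun y => K (mul y (inv w))) (H.aemeasurable_lamInv _ <| by
    have := K.continuous.comp_continuousOn (continuousOn_mul_inv' w)
    rwa [hw] at this).aestronglyMeasurable]
  change ∫ t, F t * K (mul (inv t) (mul x (inv w))) ∂(H.lam (r (mul x (inv w)))) = _
  rw [r_mul _ _ e]
  refine integral_congr_ae ?_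
  filter_upwards [H.ae_r (r x)] with t ht
  rw [mul_assoc _ _ _ (by rw [s_inv, ht]) e]

lemma regRep_invol (F : C_c(G, ℂ)) : H.regRep (invol F) = star (H.regRep F) := by
  refine Subtype.ext (funext fun u => ?_)
  refine KernelOperator.op_adjoint (H.isSchur F u) ENNReal.ofReal_lt_top
    (H.isSchur (invol F) u) ENNReal.ofReal_lt_top ?_
  filter_upwards [H.ae_s u] with x hx
  filter_upwards [H.ae_s u] with w hw
  change star (F (inv (mul x (inv w)))) = _
  rw [inv_mul_rev _ _ (by rw [r_inv, hx, hw]), inv_inv]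

/-- The `*`-algebra `{⊕_u π_u(F) : F ∈ C_c(G)}`. -/
noncomputable def regImage : NonUnitalStarSubalgebra ℂ H.OpFamily where
  carrier := Set.range H.regRep
  add_mem' := by
    rintro _ _ ⟨F, rfl⟩ ⟨K, rfl⟩
    exact ⟨F + K, H.regRep_add F K⟩
  zero_mem' := ⟨0, by simpa using H.regRep_smul 0 0⟩
  mul_mem' := by
    rintro _ _ ⟨F, rfl⟩ ⟨K, rfl⟩
    exact ⟨H.conv F K, H.regRep_conv F K⟩
  smul_mem' := by
    rintro c _ ⟨F, rfl⟩
    exact ⟨c • F, H.regRep_smul c F⟩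
  star_mem' := by
    rintro _ ⟨F, rfl⟩
    exact ⟨invol F, H.regRep_invol F⟩

/-- The reduced C*-algebra of `G`: the completion of `C_c(G)` in the norm `‖·‖_red`, realized as
the closure of the image of `C_c(G)` under the representation `⊕_u π_u`, which satisfies
`‖⊕_u π_u(F)‖ = ‖F‖_red`, in the C*-algebra of bounded families of operators on the `L²(G_u)`. -/
noncomputable def cstarRed : NonUnitalStarSubalgebra ℂ H.OpFamily :=
  H.regImage.topologicalClosure

/-- The canonical map `C_c(G) → C*_red(G)`. -/
noncomputable def toCstarRed (F : C_c(G, ℂ)) : H.cstarRed :=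
  ⟨H.regRep F, H.regImage.le_topologicalClosure ⟨F, rfl⟩⟩

/-- The section `u ↦ f^u` of the Hilbert bundle `{L²(G^u)}` given by `f ∈ C_c(G)`. -/
noncomputable def sec (f : C_c(G, ℂ)) (u : G₀) : Lp ℂ 2 (H.lam u) :=
  (f.continuous.memLp_of_hasCompactSupport f.hasCompactSupport).toLp f

lemma sec_coeFn (f : C_c(G, ℂ)) (u : G₀) : H.sec f u =ᵐ[H.lam u] f := MemLp.coeFn_toLp _

lemma sec_add (f g : C_c(G, ℂ)) (u : G₀) : H.sec (f + g) u = H.sec f u + H.sec g u := rfl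

lemma sec_smul (c : ℂ) (f : C_c(G, ℂ)) (u : G₀) : H.sec (c • f) u = c • H.sec f u := rfl

lemma continuous_inner_sec (f g : C_c(G, ℂ)) :
    Continuous fun u => (inner ℂ (H.sec f u) (H.sec g u) : ℂ) := by
  let k : C_c(G, ℂ) := ⟨⟨fun t => star (f t) * g t, by fun_prop⟩,
    g.hasCompactSupport.mul_left⟩
  refine (H.continuous_integral k).congr fun u => ?_
  rw [L2.inner_def]
  refine integral_congr_ae ?_
  filter_upwards [H.sec_coeFn f u, H.sec_coeFn g u] with t h1 h2
  rw [h1, h2, RCLike.inner_apply, mul_comm]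
  rfl

lemma continuous_norm_sec (f : C_c(G, ℂ)) : Continuous fun u => ‖H.sec f u‖ := by
  have h := (Complex.continuous_re.comp (H.continuous_inner_sec f f)).sqrt
  refine h.congr fun u => ?_
  rw [norm_eq_sqrt_re_inner (𝕜 := ℂ)]
  rfl

lemma hasCompactSupport_norm_sec (f : C_c(G, ℂ)) : HasCompactSupport fun u => ‖H.sec f u‖ := by
  have := t2_units G
  refine HasCompactSupport.intro (f.hasCompactSupport.isCompact.image continuous_r) fun u hu => ?_
  rw [norm_eq_zero]
  refine Lp.ext ?_
  filter_upwards [H.sec_coeFn f u, H.ae_r u, Lp.coeFn_zero ℂ 2 (H.lam u)] with t h1 h2 h3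
  rw [h1, h3, image_eq_zero_of_notMem_tsupport fun h => hu ⟨t, h, h2⟩, Pi.zero_apply]

/-- A section of `{L²(G^u)}` is continuous if it is locally uniformly close to sections given by
elements of `C_c(G)`. -/
def IsContinuousSection (ξ : ∀ u, Lp ℂ 2 (H.lam u)) : Prop :=
  ∀ u₀ : G₀, ∀ ε : ℝ, 0 < ε → ∃ f : C_c(G, ℂ), ∀ᶠ u in 𝓝 u₀, ‖ξ u - H.sec f u‖ < ε

lemma IsContinuousSection.add {ξ η : ∀ u, Lp ℂ 2 (H.lam u)} (hξ : H.IsContinuousSection ξ)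
    (hη : H.IsContinuousSection η) : H.IsContinuousSection (ξ + η) := by
  intro u₀ ε hε
  obtain ⟨f, hf⟩ := hξ u₀ (ε / 2) (by positivity)
  obtain ⟨g, hg⟩ := hη u₀ (ε / 2) (by positivity)
  refine ⟨f + g, ?_⟩
  filter_upwards [hf, hg] with u h1 h2
  rw [sec_add, Pi.add_apply, add_sub_add_comm]
  exact (norm_add_le _ _).trans_lt (by linarith)

lemma IsContinuousSection.smul {ξ : ∀ u, Lp ℂ 2 (H.lam u)} (hξ : H.IsContinuousSection ξ)
    {M : ℝ} (hM : ∀ u, ‖ξ u‖ ≤ M) {b : G₀ → ℂ} (hb : Continuous b) :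
    H.IsContinuousSection fun u => b u • ξ u := by
  intro u₀ ε hε
  obtain ⟨f, hf⟩ := hξ u₀ (ε / (2 * (‖b u₀‖ + 1))) (by positivity)
  have hM0 : 0 ≤ M := (norm_nonneg _).trans (hM u₀)
  have e : ∀ᶠ u in 𝓝 u₀, ‖b u - b u₀‖ < ε / (2 * (M + 1)) := by
    have hc : Continuous fun u => ‖b u - b u₀‖ := by fun_prop
    exact hc.continuousAt.eventually_lt continuousAt_const (by simpa using by positivity)
  refine ⟨b u₀ • f, ?_⟩
  filter_upwards [hf, e] with u h1 h2
  have hd : b u • ξ u - H.sec (b u₀ • f) u = (b u - b u₀) • ξ u + b u₀ • (ξ u - H.sec f u) := by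
    rw [sec_smul]; module
  rw [hd]
  refine (norm_add_le _ _).trans_lt ?_
  rw [norm_smul, norm_smul]
  have i1 : ‖b u - b u₀‖ * ‖ξ u‖ ≤ ε / (2 * (M + 1)) * M := by
    gcongr
    exact hM u
  have i2 : ‖b u₀‖ * ‖ξ u - H.sec f u‖ ≤ ‖b u₀‖ * (ε / (2 * (‖b u₀‖ + 1))) := by gcongr
  have i3 : ε / (2 * (M + 1)) * M < ε / 2 := by
    rw [div_mul_eq_mul_div, div_lt_div_iff₀ (by positivity) (by positivity)]
    nlinarith
  have i4 : ‖b u₀‖ * (ε / (2 * (‖b u₀‖ + 1))) < ε / 2 := by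
    rw [mul_div_assoc', div_lt_div_iff₀ (by positivity) (by positivity)]
    nlinarith [norm_nonneg (b u₀)]
  linarith

lemma IsContinuousSection.continuous_inner {ξ η : ∀ u, Lp ℂ 2 (H.lam u)}
    (hξ : H.IsContinuousSection ξ) (hη : H.IsContinuousSection η)
    {M : ℝ} (hM : ∀ u, ‖ξ u‖ ≤ M) (hM' : ∀ u, ‖η u‖ ≤ M) :
    Continuous fun u => (inner ℂ (ξ u) (η u) : ℂ) := by
  refine continuous_of_locally_uniform_approx_of_continuousAt fun u₀ V hV => ?_
  obtain ⟨ε, hε, hεV⟩ := Metric.mem_uniformity_dist.1 hV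
  have hM0 : 0 ≤ M := (norm_nonneg _).trans (hM u₀)
  set δ := min 1 (ε / (2 * (M + 1))) with hδ
  have hδ0 : 0 < δ := by positivity
  obtain ⟨f, hf⟩ := hξ u₀ δ hδ0
  obtain ⟨g, hg⟩ := hη u₀ δ hδ0
  refine ⟨_, hf.and hg, fun u => (inner ℂ (H.sec f u) (H.sec g u) : ℂ),
    (H.continuous_inner_sec f g).continuousAt, ?_⟩
  rintro u ⟨h1, h2⟩
  refine hεV ?_
  rw [dist_eq_norm]
  have hd : (inner ℂ (ξ u) (η u) : ℂ) - inner ℂ (H.sec f u) (H.sec g u) =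
      inner ℂ (ξ u - H.sec f u) (η u) + inner ℂ (H.sec f u) (η u - H.sec g u) := by
    rw [inner_sub_left, inner_sub_right]; ring
  have hfM : ‖H.sec f u‖ ≤ M + 1 := by
    have h3 : H.sec f u = ξ u - (ξ u - H.sec f u) := by abel
    rw [h3]
    exact (norm_sub_le _ _).trans (add_le_add (hM u) (h1.le.trans (min_le_left _ _)))
  rw [hd]
  have hδM : δ * (M + 1) ≤ ε / 2 := by
    have : δ ≤ ε / (2 * (M + 1)) := min_le_right _ _
    calc δ * (M + 1) ≤ ε / (2 * (M + 1)) * (M + 1) := by gcongr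
      _ = ε / 2 := by field_simp
  calc _ ≤ ‖ξ u - H.sec f u‖ * ‖η u‖ + ‖H.sec f u‖ * ‖η u - H.sec g u‖ :=
        (norm_add_le _ _).trans (add_le_add (norm_inner_le_norm _ _) (norm_inner_le_norm _ _))
    _ ≤ ‖ξ u - H.sec f u‖ * (M + 1) + (M + 1) * ‖η u - H.sec g u‖ := by
        gcongr
        exact (hM' u).trans (by linarith)
    _ < δ * (M + 1) + (M + 1) * δ := by gcongr
    _ ≤ ε := by linarith

/-- The space `E²` of continuous sections of `{L²(G^u)}` that vanish at infinity, with the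
supremum norm. -/
noncomputable def E2sub : Submodule ℂ (lp (fun u : G₀ => Lp ℂ 2 (H.lam u)) ∞) where
  carrier := {ξ | H.IsContinuousSection (fun u => ξ u) ∧
    Tendsto (fun u => ‖ξ u‖) (cocompact G₀) (𝓝 0)}
  add_mem' := by
    rintro ξ η ⟨h1, h2⟩ ⟨h3, h4⟩
    refine ⟨IsContinuousSection.add H h1 h3, ?_⟩
    exact squeeze_zero (fun _ => norm_nonneg _) (fun u => norm_add_le (ξ u) (η u))
      (by simpa using h2.add h4)
  zero_mem' := ⟨fun u₀ ε hε => ⟨0, Eventually.of_forall fun u => by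
    have : H.sec 0 u = 0 := by simpa using H.sec_smul 0 0 u
    simpa [this] using hε⟩,
    by simpa using (tendsto_const_nhds : Tendsto (fun _ : G₀ => (0 : ℝ)) (cocompact G₀) (𝓝 0))⟩
  smul_mem' := by
    rintro c ξ ⟨h1, h2⟩
    refine ⟨IsContinuousSection.smul H h1 (lp.norm_apply_le_norm (by simp) ξ)
      (b := fun _ => c) continuous_const, ?_⟩
    have := h2.const_mul ‖c‖
    rw [mul_zero] at this
    exact this.congr fun u => (norm_smul _ _).symm

/-- The Banach space `E²`. -/
def E2 : Type _ := H.E2sub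

noncomputable instance : NormedAddCommGroup H.E2 := inferInstanceAs (NormedAddCommGroup H.E2sub)

noncomputable instance : NormedSpace ℂ H.E2 := inferInstanceAs (NormedSpace ℂ H.E2sub)

noncomputable instance : CoeFun H.E2 fun _ => ∀ u, Lp ℂ 2 (H.lam u) := ⟨fun ξ => ξ.1.1⟩

variable {H} in
lemma E2.ext {ξ η : H.E2} (h : ∀ u, ξ u = η u) : ξ = η := Subtype.ext (Subtype.ext (funext h))

variable {H} in
lemma E2.norm_apply_le (ξ : H.E2) (u : G₀) : ‖ξ u‖ ≤ ‖ξ‖ :=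
  lp.norm_apply_le_norm (by simp) ξ.1 u

variable {H} in
lemma E2.norm_eq (ξ : H.E2) : ‖ξ‖ = ⨆ u, ‖ξ u‖ := lp.norm_eq_ciSup ξ.1

/-- The inclusion of `C_c(G)` in `E²`. -/
noncomputable def toE2 (f : C_c(G, ℂ)) : H.E2 :=
  ⟨⟨H.sec f, memℓp_infty ((H.continuous_norm_sec f).bddAbove_range_of_hasCompactSupport
    (H.hasCompactSupport_norm_sec f))⟩, fun _ ε hε => ⟨f, Eventually.of_forall fun u => by
      simpa using hε⟩, by
    refine tendsto_const_nhds.congr' ?_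
    filter_upwards [(H.hasCompactSupport_norm_sec f).isCompact.compl_mem_cocompact] with u hu
    exact (image_eq_zero_of_notMem_tsupport (f := fun u => ‖H.sec f u‖) hu).symm⟩

/-- The action of `C₀(G⁰)` on `E²`, `(b ξ)(u) = b(u) ξ(u)`. -/
noncomputable instance : SMul C₀(G₀, ℂ) H.E2 where
  smul b ξ := ⟨⟨fun u => b u • ξ u, memℓp_infty ⟨‖b.toBCF‖ * ‖ξ‖, by
      rintro _ ⟨u, rfl⟩
      change ‖b u • ξ u‖ ≤ _
      rw [norm_smul]
      exact mul_le_mul (b.toBCF.norm_coe_le_norm u) (ξ.norm_apply_le u) (norm_nonneg _)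
        (norm_nonneg _)⟩⟩,
    IsContinuousSection.smul H ξ.2.1 ξ.norm_apply_le b.continuous, by
      refine squeeze_zero (fun _ => norm_nonneg _) (fun u => ?_)
        (by simpa using ξ.2.2.const_mul ‖b.toBCF‖)
      change ‖b u • ξ u‖ ≤ _
      rw [norm_smul]
      exact mul_le_mul_of_nonneg_right (b.toBCF.norm_coe_le_norm u) (norm_nonneg _)⟩

/-- The `C₀(G⁰)`-valued inner product on `E²`, `⟨ξ, η⟩(u) = (ξ(u), η(u))`, conjugate linear in the
first variable. -/
noncomputable def innerE2 (ξ η : H.E2) : C₀(G₀, ℂ) where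
  toFun u := inner ℂ (ξ u) (η u)
  continuous_toFun := IsContinuousSection.continuous_inner H ξ.2.1 η.2.1 (M := max ‖ξ‖ ‖η‖)
    (fun u => (ξ.norm_apply_le u).trans (le_max_left _ _))
    (fun u => (η.norm_apply_le u).trans (le_max_right _ _))
  zero_at_infty' := by
    rw [tendsto_zero_iff_norm_tendsto_zero]
    refine squeeze_zero (fun _ => norm_nonneg _) (fun u => (norm_inner_le_norm _ _).trans
      (mul_le_mul_of_nonneg_right (ξ.norm_apply_le u) (norm_nonneg _))) ?_
    simpa using η.2.2.const_mul ‖ξ‖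

/-- `E²` is a Hilbert `C₀(G⁰)`-module. -/
noncomputable instance : CStarModule C₀(G₀, ℂ) H.E2 where
  inner := H.innerE2
  inner_add_right {ξ η ζ} := ZeroAtInftyContinuousMap.ext fun u =>
    inner_add_right (𝕜 := ℂ) (ξ u) (η u) (ζ u)
  inner_self_nonneg {ξ} := fun u => by
    change (0 : ℂ) ≤ inner ℂ (ξ u) (ξ u)
    exact Complex.nonneg_iff.2 ⟨inner_self_nonneg (𝕜 := ℂ), (inner_self_im (𝕜 := ℂ) _).symm⟩
  inner_self {ξ} := by
    constructor
    · intro h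
      refine E2.ext fun u => ?_
      have := DFunLike.congr_fun h u
      exact inner_self_eq_zero.1 this
    · rintro rfl
      exact ZeroAtInftyContinuousMap.ext fun u =>
        inner_zero_left (𝕜 := ℂ) (0 : Lp ℂ 2 (H.lam u))
  inner_op_smul_right {b ξ η} := ZeroAtInftyContinuousMap.ext fun u =>
    inner_smul_right (𝕜 := ℂ) (ξ u) (η u) (b u)
  inner_smul_right_complex {c ξ η} :=
    ZeroAtInftyContinuousMap.ext fun u => inner_smul_right (𝕜 := ℂ) (ξ u) (η u) c
  star_inner ξ η := ZeroAtInftyContinuousMap.ext fun u =>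
    inner_conj_symm (𝕜 := ℂ) (η u) (ξ u)
  norm_eq_sqrt_norm_inner_self ξ := by
    have h1 : ∀ u, ‖H.innerE2 ξ ξ u‖ = ‖ξ u‖ ^ 2 := fun u => by
      change ‖(inner ℂ (ξ u) (ξ u) : ℂ)‖ = _
      rw [inner_self_eq_norm_sq_to_K]; simp
    have h0 : ∀ u, ‖H.innerE2 ξ ξ u‖ ≤ ‖H.innerE2 ξ ξ‖ := fun u =>
      (H.innerE2 ξ ξ).toBCF.norm_coe_le_norm u
    symm
    rw [Real.sqrt_eq_iff_mul_self_eq (norm_nonneg _) (norm_nonneg _)]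
    refine le_antisymm ?_ ?_
    · rw [← ZeroAtInftyContinuousMap.norm_toBCF_eq_norm]
      refine (BoundedContinuousFunction.norm_le (by positivity)).2 fun u => ?_
      change ‖H.innerE2 ξ ξ u‖ ≤ _
      rw [h1, ← sq]
      exact pow_le_pow_left₀ (norm_nonneg _) (ξ.norm_apply_le u) 2
    · have h2 : ‖ξ‖ ≤ √‖H.innerE2 ξ ξ‖ := by
        rw [E2.norm_eq]
        refine Real.iSup_le (fun u => ?_) (Real.sqrt_nonneg _)
        rw [Real.le_sqrt (norm_nonneg _) (norm_nonneg _), ← h1]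
        exact h0 u
      have := (Real.le_sqrt (norm_nonneg _) (norm_nonneg _)).1 h2
      rwa [← sq]

end HaarSystem
end TopologicalGroupoid

/-! Inversion is a unitary from $L^2(G_u,\lambda_u)$ to $L^2(G^u,\lambda^u)$, and it carries
$\pi_u(F^\vee)$ to right convolution by $F$ (`flip_regRepFiber_check`). Thus $R_F$ is, fibre by
fibre, a copy of $\bigoplus_u\pi_u(F^\vee)$. It is simplest to let all of $C^*_{red}(G)$ act on
$E^2$ and to define $R_F$ as the image of $F^\vee$.

The fibrewise action preserves continuity of sections because elements of $C^*_{red}(G)$ are norm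
limits of elements of $C_c(G)$, which map $C_c(G)\subset E^2$ into itself
(`isContinuousSection_fiberOp`). It is adjointable because $C^*_{red}(G)$ contains adjoints. It is
isometric because every $f^u$ is the value at $u$ of a section in $C_c(G)$ whose sup norm is at most
$\|f^u\|$, and such vectors are dense in $L^2(G^u)$ (`norm_fiberOp_sec_le`, `norm_moduleRep`). An
isometric image of a complete algebra is closed, so it is exactly the closure of the operators $R_F$
(`range_moduleRep`).

The passage from $F^\vee$ to $F$ is transposition: with $C$ complex conjugation on $L^2(G_u)$,
$\pi_u(F^\vee)=C\,\pi_u(F)^*C$ (`transposeLp_regRepFiber`). This is a linear, isometric,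
antimultiplicative operation, so $\|F^\vee\|_{red}=\|F\|_{red}$ and $F\mapsto R_F$ reverses
products. The bound by the $I$-norm is Schur's test for $\pi_u(F)$, and uniqueness of the extension
is density of $C_c(G)$ in $E^2$ (`dense_range_toE2`). -/

namespace TopologicalGroupoid.HaarSystem

variable {G G₀ : Type*} [TopologicalSpace G] [TopologicalSpace G₀] [TopologicalGroupoid G G₀]
  [MeasurableSpace G] (H : HaarSystem G)
  [T2Space G] [LocallyCompactSpace G] [SecondCountableTopology G] [BorelSpace G]

/-! ### Inversion as a unitary between the two kinds of fibre -/

section Flip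

lemma measurePreserving_inv (u : G₀) : MeasurePreserving inv (H.lam u) (H.lamInv u) :=
  ⟨measurable_inv, rfl⟩

lemma measurePreserving_inv' (u : G₀) : MeasurePreserving inv (H.lamInv u) (H.lam u) := by
  refine ⟨measurable_inv, ?_⟩
  have h : (inv : G → G) ∘ inv = id := funext inv_inv
  rw [lamInv, Measure.map_map measurable_inv measurable_inv, h, Measure.map_id]

/-- The unitary `L²(G_u) → L²(G^u)`, `ξ ↦ ξ ∘ inv`. -/
noncomputable def flip (u : G₀) : Lp ℂ 2 (H.lamInv u) ≃ₗᵢ[ℂ] Lp ℂ 2 (H.lam u) where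
  toLinearEquiv := LinearEquiv.ofLinearMap
    (Lp.compMeasurePreservingₗᵢ ℂ inv (H.measurePreserving_inv u)).toLinearMap
    (Lp.compMeasurePreservingₗᵢ ℂ inv (H.measurePreserving_inv' u)).toLinearMap
    (by
      ext1 ξ
      refine Lp.ext ?_
      have h1 := Lp.coeFn_compMeasurePreserving ξ (H.measurePreserving_inv' u)
      have h2 := Lp.coeFn_compMeasurePreserving
        (Lp.compMeasurePreserving inv (H.measurePreserving_inv' u) ξ) (H.measurePreserving_inv u)
      filter_upwards [h2, (H.measurePreserving_inv u).quasiMeasurePreserving.ae h1] with x i1 i2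
      refine i1.trans ?_
      simp only [Function.comp]
      rw [i2, Function.comp, inv_inv]
      rfl)
    (by
      ext1 ξ
      refine Lp.ext ?_
      have h1 := Lp.coeFn_compMeasurePreserving ξ (H.measurePreserving_inv u)
      have h2 := Lp.coeFn_compMeasurePreserving
        (Lp.compMeasurePreserving inv (H.measurePreserving_inv u) ξ) (H.measurePreserving_inv' u)
      filter_upwards [h2, (H.measurePreserving_inv' u).quasiMeasurePreserving.ae h1] with x i1 i2
      refine i1.trans ?_
      simp only [Function.comp]
      rw [i2, Function.comp, inv_inv]
      rfl)
  norm_map' ξ := (Lp.compMeasurePreservingₗᵢ ℂ inv (H.measurePreserving_inv u)).norm_map ξ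

lemma flip_coeFn (u : G₀) (ξ : Lp ℂ 2 (H.lamInv u)) :
    H.flip u ξ =ᵐ[H.lam u] fun x => ξ (inv x) :=
  Lp.coeFn_compMeasurePreserving ξ (H.measurePreserving_inv u)

lemma flip_symm_coeFn (u : G₀) (ξ : Lp ℂ 2 (H.lam u)) :
    (H.flip u).symm ξ =ᵐ[H.lamInv u] fun x => ξ (inv x) :=
  Lp.coeFn_compMeasurePreserving ξ (H.measurePreserving_inv' u)

lemma check_check (F : C_c(G, ℂ)) : check (check F) = F := by
  ext x
  exact congrArg F (inv_inv x)

lemma conv_apply (f F : C_c(G, ℂ)) (x : G) :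
    H.conv f F x = ∫ t, f t * F (mul (inv t) x) ∂(H.lam (r x)) := rfl

lemma check_apply (F : C_c(G, ℂ)) (x : G) : check F x = F (inv x) := rfl

/-- Under the unitary `flip`, the operator `π_u(F^∨)` becomes right convolution by `F`. -/
lemma flip_regRepFiber_check (f F : C_c(G, ℂ)) (u : G₀) :
    H.flip u (H.regRepFiber (check F) u ((H.flip u).symm (H.sec f u))) =
      H.sec (H.conv f F) u := by
  refine Lp.ext ?_
  have hsec : (H.flip u).symm (H.sec f u) =ᵐ[H.lamInv u] check f := by
    filter_upwards [H.flip_symm_coeFn u (H.sec f u),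
      (H.measurePreserving_inv' u).quasiMeasurePreserving.ae (H.sec_coeFn f u)] with x h1 h2
    rw [h1, h2, check_apply]
  have hop := KernelOperator.op_coeFn (H.isSchur (check F) u) ENNReal.ofReal_lt_top
    ((H.flip u).symm (H.sec f u))
  filter_upwards [H.flip_coeFn u (H.regRepFiber (check F) u ((H.flip u).symm (H.sec f u))),
    -- The kernel formula holds almost everywhere on $G_u$; as inversion is measure preserving, it
    -- holds at $x^{-1}$ for almost every $x\in G^u$.
    (H.measurePreserving_inv u).quasiMeasurePreserving.ae hop, H.sec_coeFn (H.conv f F) u,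
    H.ae_r u] with x h1 h2 h3 hx
  subst hx
  rw [h1, h3, H.conv_apply]
  refine h2.trans ?_
  -- The product is continuous only on composable pairs, so measurability comes from continuity on
  -- the closed fibre that carries the measure.
  have hm : AEStronglyMeasurable (fun w => check F (mul (inv x) (inv w)) * check f w)
      (H.lamInv (r x)) := by
    have := H.aemeasurable_lamInv (s (inv x))
      ((check F).continuous.comp_continuousOn (continuousOn_mul_inv (inv x)))
    rw [s_inv] at this
    exact this.aestronglyMeasurable.mul (check f).continuous.aestronglyMeasurable
  -- With $w=t^{-1}$ the kernel $F^\vee(x^{-1}w^{-1})$ becomes $F^\vee(x^{-1}t)=F(t^{-1}x)$ and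
  -- $f^\vee(w)$ becomes $f(t)$, which is the integrand of $f*F$.
  calc _ = ∫ w, check F (mul (inv x) (inv w)) * check f w ∂(H.lamInv (r x)) := by
        refine integral_congr_ae ?_
        filter_upwards [hsec] with w hw
        rw [hw]
    _ = ∫ t, check F (mul (inv x) (inv (inv t))) * check f (inv t) ∂(H.lam (r x)) :=
        integral_map measurable_inv.aemeasurable hm
    _ = _ := by
        refine integral_congr_ae ?_
        filter_upwards [H.ae_r (r x)] with t ht
        rw [check_apply, check_apply, inv_inv, inv_mul_rev _ _ (by rw [s_inv, ht]), inv_inv,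
          mul_comm]

end Flip

/-! ### Transposition of operators on $L^2$ -/

section Conj

variable {α : Type*} [MeasurableSpace α] (μ : Measure α)

/-- Complex conjugation on `L²(μ)`. -/
noncomputable def conjLp : Lp ℂ 2 μ →L⋆[ℂ] Lp ℂ 2 μ :=
  LinearMap.mkContinuous
    { toFun := star
      map_add' := fun ξ η => by
        refine Lp.ext ?_
        filter_upwards [Lp.coeFn_star (ξ + η), Lp.coeFn_star ξ, Lp.coeFn_star η,
          Lp.coeFn_add ξ η, Lp.coeFn_add (star ξ) (star η)] with x h1 h2 h3 h4 h5
        rw [h1, h5, Pi.add_apply, h2, h3, Pi.star_apply, Pi.star_apply, Pi.star_apply, h4,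
          Pi.add_apply, star_add]
      map_smul' := fun c ξ => by
        refine Lp.ext ?_
        filter_upwards [Lp.coeFn_star (c • ξ), Lp.coeFn_star ξ, Lp.coeFn_smul c ξ,
          Lp.coeFn_smul (starRingEnd ℂ c) (star ξ)] with x h1 h2 h3 h4
        rw [h1, h4, Pi.smul_apply, h2, Pi.star_apply, Pi.star_apply, h3, Pi.smul_apply, star_smul]
        rfl }
    1 fun ξ => by
      rw [one_mul]
      refine Lp.norm_le_norm_of_ae_le ?_
      filter_upwards [Lp.coeFn_star ξ] with x hx
      change ‖(star ξ : Lp ℂ 2 μ) x‖ ≤ _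
      rw [hx, Pi.star_apply, norm_star]

variable {μ}

lemma conjLp_apply (ξ : Lp ℂ 2 μ) : conjLp μ ξ = star ξ := rfl

lemma conjLp_conjLp (ξ : Lp ℂ 2 μ) : conjLp μ (conjLp μ ξ) = ξ := star_star ξ

/-- An involution that does not increase norms preserves them. -/
lemma norm_conjLp (ξ : Lp ℂ 2 μ) : ‖conjLp μ ξ‖ = ‖ξ‖ := by
  have h (η : Lp ℂ 2 μ) : ‖conjLp μ η‖ ≤ ‖η‖ :=
    ((conjLp μ).le_of_opNorm_le (LinearMap.mkContinuous_norm_le _ zero_le_one _) η).trans_eq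
      (one_mul _)
  refine le_antisymm (h ξ) ?_
  simpa only [conjLp_conjLp] using h (conjLp μ ξ)

lemma inner_conjLp (ξ η : Lp ℂ 2 μ) :
    inner ℂ (conjLp μ ξ) (conjLp μ η) = inner ℂ η ξ := by
  rw [L2.inner_def, L2.inner_def]
  refine integral_congr_ae ?_
  filter_upwards [Lp.coeFn_star ξ, Lp.coeFn_star η] with x h1 h2
  rw [conjLp_apply, conjLp_apply, h1, h2]
  simp [mul_comm]

/-- The transpose `C T* C` of an operator on `L²(μ)`, where `C` is complex conjugation. -/
noncomputable def transposeLp (T : Lp ℂ 2 μ →L[ℂ] Lp ℂ 2 μ) : Lp ℂ 2 μ →L[ℂ] Lp ℂ 2 μ :=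
  (conjLp μ).comp ((star T).comp (conjLp μ))

lemma transposeLp_apply (T : Lp ℂ 2 μ →L[ℂ] Lp ℂ 2 μ) (ξ : Lp ℂ 2 μ) :
    transposeLp T ξ = conjLp μ (star T (conjLp μ ξ)) := rfl

lemma transposeLp_add (S T : Lp ℂ 2 μ →L[ℂ] Lp ℂ 2 μ) :
    transposeLp (S + T) = transposeLp S + transposeLp T := by
  ext1 ξ
  simp [transposeLp_apply, star_add]

/-- The adjoint conjugates the scalar and the outer conjugation undoes it. Hence transposition,
unlike the adjoint, is complex linear. -/
lemma transposeLp_smul (c : ℂ) (T : Lp ℂ 2 μ →L[ℂ] Lp ℂ 2 μ) :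
    transposeLp (c • T) = c • transposeLp T := by
  ext1 ξ
  simp [transposeLp_apply, star_smul]

lemma transposeLp_mul (S T : Lp ℂ 2 μ →L[ℂ] Lp ℂ 2 μ) :
    transposeLp (S * T) = transposeLp T * transposeLp S := by
  ext1 ξ
  simp [transposeLp_apply, conjLp_conjLp, star_mul]

/-- Conjugation $C$ is antiunitary, $(C\xi,C\eta)=(\eta,\xi)$, so the adjoint of $CT^*C$ is $CTC$.
-/
lemma transposeLp_star (T : Lp ℂ 2 μ →L[ℂ] Lp ℂ 2 μ) :
    transposeLp (star T) = star (transposeLp T) := by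
  rw [ContinuousLinearMap.star_eq_adjoint (transposeLp T), ContinuousLinearMap.eq_adjoint_iff]
  intro ξ η
  rw [transposeLp_apply, transposeLp_apply, star_star, ← conjLp_conjLp η, inner_conjLp,
    conjLp_conjLp, ← conjLp_conjLp ξ, inner_conjLp, conjLp_conjLp,
    ContinuousLinearMap.star_eq_adjoint, ContinuousLinearMap.adjoint_inner_left]

lemma transposeLp_transposeLp (T : Lp ℂ 2 μ →L[ℂ] Lp ℂ 2 μ) :
    transposeLp (transposeLp T) = T := by
  ext1 ξ
  rw [transposeLp_apply, ← transposeLp_star, transposeLp_apply, star_star]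
  simp [conjLp_conjLp]

lemma norm_transposeLp_le (T : Lp ℂ 2 μ →L[ℂ] Lp ℂ 2 μ) : ‖transposeLp T‖ ≤ ‖T‖ := by
  refine ContinuousLinearMap.opNorm_le_bound _ (norm_nonneg _) fun ξ => ?_
  rw [transposeLp_apply, norm_conjLp, ← norm_star T, ← norm_conjLp ξ]
  exact (star T).le_opNorm _

lemma norm_transposeLp (T : Lp ℂ 2 μ →L[ℂ] Lp ℂ 2 μ) : ‖transposeLp T‖ = ‖T‖ :=
  le_antisymm (norm_transposeLp_le T) (by
    conv_lhs => rw [← transposeLp_transposeLp T]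
    exact norm_transposeLp_le _)

end Conj

/-- Transposition exchanges the two variables of a kernel, and $F(wx^{-1})=F^\vee(xw^{-1})$. In the
proof the adjoint is $\pi_u(F^*)$, whose kernel is the complex conjugate of the one for $F^\vee$;
the two conjugations then remove the bar. -/
lemma transposeLp_regRepFiber (F : C_c(G, ℂ)) (u : G₀) :
    transposeLp (H.regRepFiber F u) = H.regRepFiber (check F) u := by
  have hs : star (H.regRepFiber F u) = H.regRepFiber (invol F) u :=
    (congrArg (fun T : H.OpFamily => T.1 u) (H.regRep_invol F)).symm
  ext1 ξ
  refine Lp.ext ?_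
  rw [transposeLp_apply, hs]
  filter_upwards [Lp.coeFn_star (H.regRepFiber (invol F) u (conjLp _ ξ)),
    KernelOperator.op_coeFn (H.isSchur (check F) u) ENNReal.ofReal_lt_top ξ,
    KernelOperator.op_coeFn (H.isSchur (invol F) u) ENNReal.ofReal_lt_top (conjLp _ ξ)]
    with x h1 h2 h3
  refine h1.trans (Eq.trans ?_ h2.symm)
  rw [Pi.star_apply]
  refine (congrArg star h3).trans ?_
  refine (integral_conj (𝕜 := ℂ)).symm.trans (integral_congr_ae ?_)
  filter_upwards [Lp.coeFn_star ξ] with w hw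
  rw [conjLp_apply, hw, map_mul]
  change star (star _) * star (star _) = _
  rw [star_star, star_star]
  rfl

end TopologicalGroupoid.HaarSystem

namespace TopologicalGroupoid.HaarSystem

variable {G G₀ : Type*} [TopologicalSpace G] [TopologicalSpace G₀] [TopologicalGroupoid G G₀]
  [MeasurableSpace G] (H : HaarSystem G)
  [T2Space G] [LocallyCompactSpace G] [SecondCountableTopology G] [BorelSpace G]

/-! ### Operator families acting on the fibres $L^2(G^u)$ -/

lemma OpFamily.norm_apply_le (T : H.OpFamily) (u : G₀) : ‖T.1 u‖ ≤ ‖T‖ :=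
  lp.norm_apply_le_norm (E := fun u : G₀ => Lp ℂ 2 (H.lamInv u) →L[ℂ] Lp ℂ 2 (H.lamInv u))
    (by simp) T u

lemma OpFamily.norm_le {T : H.OpFamily} {C : ℝ} (hC : 0 ≤ C) (h : ∀ u, ‖T.1 u‖ ≤ C) : ‖T‖ ≤ C :=
  (lp.norm_eq_ciSup (E := fun u : G₀ => Lp ℂ 2 (H.lamInv u) →L[ℂ] Lp ℂ 2 (H.lamInv u)) T).trans_le
    (Real.iSup_le h hC)

section Fiber

/-- The operator on `L²(G^u)` corresponding to the component at `u` of a family of operators on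
the spaces `L²(G_u)`. -/
noncomputable def fiberOp (u : G₀) (T : H.OpFamily) : Lp ℂ 2 (H.lam u) →L[ℂ] Lp ℂ 2 (H.lam u) :=
  (H.flip u).conjStarAlgEquiv (T.1 u)

lemma fiberOp_apply (u : G₀) (T : H.OpFamily) (ξ : Lp ℂ 2 (H.lam u)) :
    H.fiberOp u T ξ = H.flip u (T.1 u ((H.flip u).symm ξ)) := rfl

lemma norm_fiberOp_apply_le (u : G₀) (T : H.OpFamily) (ξ : Lp ℂ 2 (H.lam u)) :
    ‖H.fiberOp u T ξ‖ ≤ ‖T‖ * ‖ξ‖ := by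
  rw [fiberOp_apply, LinearIsometryEquiv.norm_map, ← (H.flip u).symm.norm_map ξ]
  exact (T.1 u).le_of_opNorm_le (OpFamily.norm_apply_le H T u) _

lemma fiberOp_add (u : G₀) (S T : H.OpFamily) :
    H.fiberOp u (S + T) = H.fiberOp u S + H.fiberOp u T :=
  map_add (H.flip u).conjStarAlgEquiv (S.1 u) (T.1 u)

lemma fiberOp_sub (u : G₀) (S T : H.OpFamily) :
    H.fiberOp u (S - T) = H.fiberOp u S - H.fiberOp u T :=
  map_sub (H.flip u).conjStarAlgEquiv (S.1 u) (T.1 u)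

lemma fiberOp_smul (u : G₀) (c : ℂ) (T : H.OpFamily) :
    H.fiberOp u (c • T) = c • H.fiberOp u T :=
  map_smul (H.flip u).conjStarAlgEquiv c (T.1 u)

lemma fiberOp_mul (u : G₀) (S T : H.OpFamily) :
    H.fiberOp u (S * T) = H.fiberOp u S * H.fiberOp u T :=
  map_mul (H.flip u).conjStarAlgEquiv (S.1 u) (T.1 u)

lemma fiberOp_star (u : G₀) (T : H.OpFamily) :
    H.fiberOp u (star T) = star (H.fiberOp u T) :=
  map_star (H.flip u).conjStarAlgEquiv (T.1 u)

lemma fiberOp_regRep_sec (f F : C_c(G, ℂ)) (u : G₀) :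
    H.fiberOp u (H.regRep (check F)) (H.sec f u) = H.sec (H.conv f F) u :=
  H.flip_regRepFiber_check f F u

lemma norm_apply_le_of_fiberOp {T : H.OpFamily} {u : G₀} {C : ℝ} (hC : 0 ≤ C)
    (h : ∀ ξ, ‖H.fiberOp u T ξ‖ ≤ C * ‖ξ‖) : ‖T.1 u‖ ≤ C := by
  refine ContinuousLinearMap.opNorm_le_bound _ hC fun ξ => ?_
  have := h (H.flip u ξ)
  rwa [fiberOp_apply, LinearIsometryEquiv.norm_map, LinearIsometryEquiv.norm_map,
    LinearIsometryEquiv.symm_apply_apply] at this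

/-- The operators are bounded uniformly in $u$, so locally uniform approximation survives if $T$ is
replaced by some $\bigoplus_u\pi_u(F)$ and $\xi$ by some $f\in C_c(G)$; and the image of $f$ is then
again in $C_c(G)$. An arbitrary bounded family need not preserve continuity, whence the restriction
to the closure of $C_c(G)$. -/
lemma isContinuousSection_fiberOp {T : H.OpFamily} (hT : T ∈ H.cstarRed)
    {ξ : ∀ u, Lp ℂ 2 (H.lam u)} (hξ : H.IsContinuousSection ξ) {M : ℝ} (hM : ∀ u, ‖ξ u‖ ≤ M) :
    H.IsContinuousSection fun u => H.fiberOp u T (ξ u) := by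
  intro u₀ ε hε
  have hM0 : 0 ≤ M := (norm_nonneg _).trans (hM u₀)
  -- Half of the error goes to replacing $T$, half to replacing $\xi$. `F` is chosen before `f`
  -- since the tolerance for `f` depends on the norm of the operator of `F`; each `+ 1` prevents a
  -- zero denominator and makes the estimate strict.
  obtain ⟨_, ⟨F, rfl⟩, hF⟩ := Metric.mem_closure_iff.1 hT (ε / (2 * (M + 1))) (by positivity)
  rw [dist_eq_norm] at hF
  obtain ⟨f, hf⟩ := hξ u₀ (ε / (2 * (‖H.regRep F‖ + 1))) (by positivity)
  -- On the fibres $L^2(G^u)$ the representation of $F$ is right convolution by $F^\vee$.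
  refine ⟨H.conv f (check F), hf.mono fun u hu => ?_⟩
  have hd : H.fiberOp u T (ξ u) - H.sec (H.conv f (check F)) u =
      H.fiberOp u (T - H.regRep F) (ξ u) + H.fiberOp u (H.regRep F) (ξ u - H.sec f u) := by
    rw [← fiberOp_regRep_sec, check_check, fiberOp_sub, map_sub, _root_.sub_apply]
    abel
  rw [hd]
  refine (norm_add_le _ _).trans_lt ?_
  have i1 : ‖H.fiberOp u (T - H.regRep F) (ξ u)‖ ≤ ε / (2 * (M + 1)) * M :=
    (H.norm_fiberOp_apply_le _ _ _).trans (mul_le_mul hF.le (hM u) (norm_nonneg _) (by positivity))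
  have i2 : ‖H.fiberOp u (H.regRep F) (ξ u - H.sec f u)‖ ≤
      ‖H.regRep F‖ * (ε / (2 * (‖H.regRep F‖ + 1))) :=
    (H.norm_fiberOp_apply_le _ _ _).trans (mul_le_mul_of_nonneg_left hu.le (norm_nonneg _))
  have i3 : ε / (2 * (M + 1)) * M < ε / 2 := by
    rw [div_mul_eq_mul_div, div_lt_div_iff₀ (by positivity) (by positivity)]
    nlinarith
  have i4 : ‖H.regRep F‖ * (ε / (2 * (‖H.regRep F‖ + 1))) < ε / 2 := by
    rw [mul_div_assoc', div_lt_div_iff₀ (by positivity) (by positivity)]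
    nlinarith [norm_nonneg (H.regRep F)]
  linarith

end Fiber

/-! ### The isometric representation of $C^*_{red}(G)$ on $E^2$ -/

section Module

/-- The operator on `E²` given by an element of the reduced C*-algebra. -/
noncomputable def moduleCLM (T : H.cstarRed) : H.E2 →L[ℂ] H.E2 :=
  LinearMap.mkContinuous
    { toFun := fun ξ => ⟨⟨fun u => H.fiberOp u T (ξ u), memℓp_infty ⟨‖(T : H.OpFamily)‖ * ‖ξ‖, by
          rintro _ ⟨u, rfl⟩
          exact (H.norm_fiberOp_apply_le _ _ _).trans
            (mul_le_mul_of_nonneg_left (ξ.norm_apply_le u) (norm_nonneg _))⟩⟩,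
        H.isContinuousSection_fiberOp T.2 ξ.2.1 ξ.norm_apply_le,
        squeeze_zero (fun _ => norm_nonneg _) (fun u => H.norm_fiberOp_apply_le u T (ξ u))
          (by simpa using ξ.2.2.const_mul ‖(T : H.OpFamily)‖)⟩
      map_add' := fun ξ η => E2.ext fun u => map_add (H.fiberOp u T) (ξ u) (η u)
      map_smul' := fun c ξ => E2.ext fun u => map_smul (H.fiberOp u T) c (ξ u) }
    ‖(T : H.OpFamily)‖ fun ξ => by
      rw [E2.norm_eq]
      exact Real.iSup_le (fun u => (H.norm_fiberOp_apply_le _ _ _).trans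
        (mul_le_mul_of_nonneg_left (ξ.norm_apply_le u) (norm_nonneg _))) (by positivity)

/-- A bounded operator on a Hilbert module may fail to have an adjoint. Here the fibrewise adjoints
do preserve continuous sections, because they form an element of the same $*$-algebra. -/
lemma inner_moduleCLM (T : H.cstarRed) (ξ η : H.E2) :
    inner C₀(G₀, ℂ) (H.moduleCLM T ξ) η = inner C₀(G₀, ℂ) ξ (H.moduleCLM (star T) η) := by
  refine ZeroAtInftyContinuousMap.ext fun u => ?_
  change inner ℂ (H.fiberOp u T (ξ u)) (η u) = inner ℂ (ξ u) (H.fiberOp u (star T.1) (η u))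
  rw [fiberOp_star, ContinuousLinearMap.star_eq_adjoint, ContinuousLinearMap.adjoint_inner_right]

/-- The adjointable operator on `E²` given by an element of the reduced C*-algebra. -/
noncomputable def moduleOp (T : H.cstarRed) : Adjointable C₀(G₀, ℂ) H.E2 :=
  ⟨H.moduleCLM T, H.moduleCLM (star T), H.inner_moduleCLM T⟩

lemma moduleOp_ext {S T : Adjointable C₀(G₀, ℂ) H.E2} (h : ∀ ξ u, S.1 ξ u = T.1 ξ u) : S = T :=
  Subtype.ext (ContinuousLinearMap.ext fun ξ => E2.ext (h ξ))

/-- The representation of the reduced C*-algebra on `E²`. -/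
noncomputable def moduleRep : H.cstarRed →⋆ₙₐ[ℂ] Adjointable C₀(G₀, ℂ) H.E2 where
  toFun := H.moduleOp
  map_smul' c T := H.moduleOp_ext fun ξ u =>
    congrArg (fun A => A (ξ u)) (H.fiberOp_smul u c (T : H.OpFamily))
  map_zero' := H.moduleOp_ext fun ξ u => by
    change H.fiberOp u (0 : H.OpFamily) (ξ u) = 0
    have := H.fiberOp_smul u 0 (0 : H.OpFamily)
    rw [zero_smul, zero_smul] at this
    rw [this, _root_.zero_apply]
  map_add' S T := H.moduleOp_ext fun ξ u =>
    congrArg (fun A => A (ξ u)) (H.fiberOp_add u (S : H.OpFamily) (T : H.OpFamily))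
  map_mul' S T := H.moduleOp_ext fun ξ u =>
    congrArg (fun A => A (ξ u)) (H.fiberOp_mul u (S : H.OpFamily) (T : H.OpFamily))
  map_star' T := (Adjointable.star_eq (H.inner_moduleCLM T)).symm

lemma moduleRep_apply (T : H.cstarRed) (ξ : H.E2) (u : G₀) :
    (H.moduleRep T).toCLM ξ u = H.fiberOp u T (ξ u) := rfl

lemma moduleRep_toCstarRed_check (f F : C_c(G, ℂ)) :
    (H.moduleRep (H.toCstarRed (check F))).toCLM (H.toE2 f) = H.toE2 (H.conv f F) :=
  E2.ext fun u => H.fiberOp_regRep_sec f F u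

lemma norm_moduleRep_le (T : H.cstarRed) : ‖H.moduleRep T‖ ≤ ‖T‖ := by
  refine ContinuousLinearMap.opNorm_le_bound (H.moduleCLM T) (norm_nonneg _) fun ξ => ?_
  rw [E2.norm_eq]
  exact Real.iSup_le (fun u => (H.norm_fiberOp_apply_le _ _ _).trans
    (mul_le_mul_of_nonneg_left (ξ.norm_apply_le u) (norm_nonneg _)))
    (mul_nonneg (norm_nonneg _) (norm_nonneg _))

/-- The product of `f ∈ C_c(G)` with the pullback along `r` of a continuous function. -/
noncomputable def smulPullback (b : C(G₀, ℂ)) (f : C_c(G, ℂ)) : C_c(G, ℂ) where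
  toFun x := b (r x) * f x
  continuous_toFun := (b.continuous.comp continuous_r).mul f.continuous
  hasCompactSupport' := f.hasCompactSupport.mul_left

/-- On $G^u$ the function $b\circ r$ is the constant $b(u)$. This allows cutting off and gluing
sections without leaving $C_c(G)$. -/
lemma sec_smulPullback (b : C(G₀, ℂ)) (f : C_c(G, ℂ)) (u : G₀) :
    H.sec (smulPullback b f) u = b u • H.sec f u := by
  refine Lp.ext ?_
  filter_upwards [H.sec_coeFn (smulPullback b f) u, H.sec_coeFn f u, H.ae_r u,
    Lp.coeFn_smul (b u) (H.sec f u)] with x h1 h2 h3 h4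
  rw [h1, h4, Pi.smul_apply, h2, ← h3]
  rfl

/-- The operator norm on $E^2$ only controls sup norms, and $f$ may be larger on other fibres than
at $u$. Rescaling $f$ along the unit space, without changing it at $u$, removes this obstacle. -/
lemma norm_fiberOp_sec_le (T : H.cstarRed) (f : C_c(G, ℂ)) (u : G₀) :
    ‖H.fiberOp u T (H.sec f u)‖ ≤ ‖H.moduleRep T‖ * ‖H.sec f u‖ := by
  rcases eq_or_ne (‖H.sec f u‖) 0 with h0 | h0
  · rw [norm_eq_zero] at h0
    simp [h0]
  · set c := ‖H.sec f u‖ with hc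
    have hc0 : 0 < c := lt_of_le_of_ne (norm_nonneg _) h0.symm
    have hm : ∀ v, 0 < max c ‖H.sec f v‖ := fun v => lt_max_of_lt_left hc0
    -- This factor truncates the fibre norms of `f` at the level `c`; it equals 1 at `u`, and `0 <
    -- c` makes it continuous.
    let b : C(G₀, ℂ) := ⟨fun v => ((c / max c ‖H.sec f v‖ : ℝ) : ℂ),
      Complex.continuous_ofReal.comp (continuous_const.div
        (continuous_const.max (H.continuous_norm_sec f)) fun v => (hm v).ne')⟩
    have hb : H.sec (smulPullback b f) u = H.sec f u := by
      have : b u = 1 := by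
        change ((c / max c ‖H.sec f u‖ : ℝ) : ℂ) = 1
        rw [← hc, max_self, div_self h0, Complex.ofReal_one]
      rw [sec_smulPullback, this, one_smul]
    have hn : ‖H.toE2 (smulPullback b f)‖ ≤ c := by
      rw [E2.norm_eq]
      refine Real.iSup_le (fun v => ?_) hc0.le
      change ‖H.sec (smulPullback b f) v‖ ≤ c
      have hbv : ‖b v‖ = c / max c ‖H.sec f v‖ := by
        change ‖((c / max c ‖H.sec f v‖ : ℝ) : ℂ)‖ = _
        rw [Complex.norm_real, Real.norm_of_nonneg (div_nonneg hc0.le (hm v).le)]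
      rw [sec_smulPullback, norm_smul, hbv, div_mul_eq_mul_div, div_le_iff₀ (hm v)]
      exact mul_le_mul_of_nonneg_left (le_max_right _ _) hc0.le
    calc ‖H.fiberOp u T (H.sec f u)‖
        = ‖((H.moduleRep T).toCLM (H.toE2 (smulPullback b f))) u‖ := by
          rw [moduleRep_apply]
          exact congrArg (fun ξ => ‖H.fiberOp u T ξ‖) hb.symm
      _ ≤ ‖(H.moduleRep T).toCLM (H.toE2 (smulPullback b f))‖ := E2.norm_apply_le _ u
      _ ≤ ‖H.moduleRep T‖ * ‖H.toE2 (smulPullback b f)‖ :=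
          (H.moduleRep T).toCLM.le_opNorm _
      _ ≤ ‖H.moduleRep T‖ * c := by gcongr

/-- This is density of continuous compactly supported functions in $L^2$ of a regular measure,
applied on all of $G$, where $\lambda^u$ is defined. -/
lemma dense_range_sec (u : G₀) : DenseRange fun f : C_c(G, ℂ) => H.sec f u := by
  intro ξ
  rw [Metric.mem_closure_range_iff]
  intro ε hε
  obtain ⟨g, hg1, hg2, hg3, hg4⟩ := (Lp.memLp ξ).exists_hasCompactSupport_eLpNorm_sub_le
    (by simp) (ε := ENNReal.ofReal (ε / 2)) (by simpa using hε)
  refine ⟨⟨⟨g, hg3⟩, hg1⟩, ?_⟩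
  have : ξ - H.sec ⟨⟨g, hg3⟩, hg1⟩ u = ((Lp.memLp ξ).sub hg4).toLp := by
    rw [MemLp.toLp_sub (Lp.memLp ξ) hg4, Lp.toLp_coeFn]
    rfl
  rw [dist_eq_norm, this, Lp.norm_toLp]
  exact (ENNReal.toReal_le_of_le_ofReal (by positivity) hg2).trans_lt (by linarith)

/-- The bound on the vectors $f^u$ is a closed condition, so it extends from this dense set to the
whole fibre; the norm of a family is the supremum over the fibres. -/
lemma norm_moduleRep (T : H.cstarRed) : ‖H.moduleRep T‖ = ‖T‖ := by
  refine le_antisymm (H.norm_moduleRep_le T) ?_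
  refine OpFamily.norm_le H (norm_nonneg _) fun u => ?_
  refine H.norm_apply_le_of_fiberOp (norm_nonneg _) fun ξ => ?_
  exact (H.dense_range_sec u).induction_on ξ
    (isClosed_le (by fun_prop) (by fun_prop)) fun f => H.norm_fiberOp_sec_le T f u

lemma isometry_moduleRep : Isometry H.moduleRep :=
  AddMonoidHomClass.isometry_of_norm _ H.norm_moduleRep

end Module

end TopologicalGroupoid.HaarSystem

/-! ### Density of $C_c(G)$ in $E^2$ -/

namespace TopologicalGroupoid

/-- The range map is a continuous left inverse of the inclusion of units, so the units are closed in
$G$. Local compactness is needed for partitions of unity on $G^0$. -/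
lemma locallyCompactSpace_units (G : Type*) {G₀ : Type*} [TopologicalSpace G] [TopologicalSpace G₀]
    [TopologicalGroupoid G G₀] [T2Space G] [LocallyCompactSpace G] : LocallyCompactSpace G₀ := by
  have := t2_units G
  have h : IsClosedEmbedding (unit : G₀ → G) :=
    Function.LeftInverse.isClosedEmbedding (f := (r : G → G₀)) (g := unit) r_unit
      continuous_r continuous_unit
  exact h.locallyCompactSpace

end TopologicalGroupoid

namespace TopologicalGroupoid.HaarSystem

variable {G G₀ : Type*} [TopologicalSpace G] [TopologicalSpace G₀] [TopologicalGroupoid G G₀]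
  [MeasurableSpace G] (H : HaarSystem G)
  [T2Space G] [LocallyCompactSpace G] [SecondCountableTopology G] [BorelSpace G]

section Density

lemma sec_sum {ι : Type*} (t : Finset ι) (f : ι → C_c(G, ℂ)) (u : G₀) :
    H.sec (∑ i ∈ t, f i) u = ∑ i ∈ t, H.sec (f i) u :=
  map_sum (AddMonoidHom.mk' (fun f : C_c(G, ℂ) => H.sec f u) fun f g => H.sec_add f g u) f _

/-- Local approximants from $C_c(G)$ are glued by a partition of unity over a compact set of units,
outside which $\xi$ is already small. Finitely many suffice, so the glued section is again in
$C_c(G)$. -/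
lemma dense_range_toE2 : DenseRange H.toE2 := by
  intro ξ
  rw [Metric.mem_closure_range_iff]
  intro ε hε
  have := t2_units G
  have := locallyCompactSpace_units G
  have hδ : 0 < ε / 2 := by positivity
  obtain ⟨K, hK, hKξ⟩ := mem_cocompact.1 (ξ.2.2.eventually_lt_const hδ)
  choose f hf using fun u₀ => ξ.2.1 u₀ (ε / 2) hδ
  choose U hU hUo huU using fun u₀ => eventually_nhds_iff.1 (hf u₀)
  obtain ⟨t, ht⟩ := hK.elim_finite_subcover U hUo fun u _ => Set.mem_iUnion.2 ⟨u, huU u⟩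
  obtain ⟨b, hb, -⟩ := PartitionOfUnity.exists_isSubordinate_of_locallyFinite_t2space hK
    (fun i : t => U i) (fun i => hUo i) (locallyFinite_of_finite _) (by
      intro u hu
      obtain ⟨v, hv, huv⟩ := Set.mem_iUnion₂.1 (ht hu)
      exact Set.mem_iUnion.2 ⟨⟨v, hv⟩, huv⟩)
  have hsum (u : G₀) : ∑ i, b i u ≤ 1 := by
    rw [← finsum_eq_sum_of_fintype]
    exact b.sum_le_one u
  let c (i : t) : C(G₀, ℂ) := ⟨fun u => (b i u : ℂ),
    Complex.continuous_ofReal.comp (b i).continuous⟩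
  let g : C_c(G, ℂ) := ∑ i : t, smulPullback (c i) (f i)
  have hg (u : G₀) : H.sec g u = ∑ i : t, (b i u : ℂ) • H.sec (f i) u := by
    rw [sec_sum]
    exact Finset.sum_congr rfl fun i _ => H.sec_smulPullback _ _ u
  refine ⟨g, lt_of_le_of_lt ?_ (half_lt_self hε)⟩
  rw [dist_eq_norm, E2.norm_eq]
  refine Real.iSup_le (fun u => ?_) hδ.le
  change ‖ξ u - H.sec g u‖ ≤ ε / 2
  -- The error is a convex combination: the weights `b i u` go with local errors, and the remaining
  -- weight, which vanishes on `K`, goes with `ξ u` itself, which is small off `K`. Each part is at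
  -- most `ε / 2`, so no constants accumulate.
  have hd : ξ u - H.sec g u = ((1 - ∑ i, b i u : ℝ) : ℂ) • ξ u +
      ∑ i : t, (b i u : ℂ) • (ξ u - H.sec (f i) u) := by
    simp only [smul_sub, Finset.sum_sub_distrib, ← Finset.sum_smul, hg]
    push_cast
    rw [sub_smul, one_smul]
    abel
  have h1 : ‖((1 - ∑ i, b i u : ℝ) : ℂ) • ξ u‖ ≤ (1 - ∑ i, b i u) * (ε / 2) := by
    rw [norm_smul, Complex.norm_real, Real.norm_of_nonneg (sub_nonneg.2 (hsum u))]
    by_cases hu : u ∈ K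
    · have := b.sum_eq_one hu
      rw [finsum_eq_sum_of_fintype] at this
      rw [this, sub_self, zero_mul, zero_mul]
    · exact mul_le_mul_of_nonneg_left (le_of_lt (hKξ hu)) (sub_nonneg.2 (hsum u))
  have h2 (i : t) : ‖(b i u : ℂ) • (ξ u - H.sec (f i) u)‖ ≤ b i u * (ε / 2) := by
    rw [norm_smul, Complex.norm_real, Real.norm_of_nonneg (b.nonneg i u)]
    by_cases hu : u ∈ U i
    · exact mul_le_mul_of_nonneg_left (hU i u hu).le (b.nonneg i u)
    · have : b i u = 0 := image_eq_zero_of_notMem_tsupport fun h => hu (hb i h)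
      simp [this]
  calc ‖ξ u - H.sec g u‖
      ≤ (1 - ∑ i, b i u) * (ε / 2) + ∑ i, b i u * (ε / 2) := by
        rw [hd]
        exact (norm_add_le _ _).trans
          (add_le_add h1 ((norm_sum_le _ _).trans (Finset.sum_le_sum fun i _ => h2 i)))
    _ = ε / 2 := by
        rw [← Finset.sum_mul]
        ring

end Density

/-! ### Transposition as an anti-automorphism of $C^*_{red}(G)$ -/

/-- The transpose of a family of operators. -/
noncomputable def transposeFamily (T : H.OpFamily) : H.OpFamily :=
  ⟨fun u => transposeLp (T.1 u), memℓp_infty ⟨‖T‖, by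
    rintro _ ⟨u, rfl⟩
    exact (norm_transposeLp _).trans_le (OpFamily.norm_apply_le H T u)⟩⟩

lemma transposeFamily_add (S T : H.OpFamily) :
    H.transposeFamily (S + T) = H.transposeFamily S + H.transposeFamily T :=
  Subtype.ext (funext fun u => transposeLp_add (S.1 u) (T.1 u))

lemma transposeFamily_smul (c : ℂ) (T : H.OpFamily) :
    H.transposeFamily (c • T) = c • H.transposeFamily T :=
  Subtype.ext (funext fun u => transposeLp_smul c (T.1 u))

lemma transposeFamily_mul (S T : H.OpFamily) :
    H.transposeFamily (S * T) = H.transposeFamily T * H.transposeFamily S :=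
  Subtype.ext (funext fun u => transposeLp_mul (S.1 u) (T.1 u))

lemma transposeFamily_star (T : H.OpFamily) :
    H.transposeFamily (star T) = star (H.transposeFamily T) :=
  Subtype.ext (funext fun u => transposeLp_star (T.1 u))

lemma transposeFamily_transposeFamily (T : H.OpFamily) :
    H.transposeFamily (H.transposeFamily T) = T :=
  Subtype.ext (funext fun u => transposeLp_transposeLp (T.1 u))

lemma norm_transposeFamily (T : H.OpFamily) : ‖H.transposeFamily T‖ = ‖T‖ := by
  have h (T : H.OpFamily) : ‖H.transposeFamily T‖ ≤ ‖T‖ :=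
    OpFamily.norm_le H (norm_nonneg _) fun u =>
      (norm_transposeLp _).trans_le (OpFamily.norm_apply_le H T u)
  refine le_antisymm (h T) ?_
  conv_lhs => rw [← H.transposeFamily_transposeFamily T]
  exact h _

lemma transposeFamily_regRep (F : C_c(G, ℂ)) :
    H.transposeFamily (H.regRep F) = H.regRep (check F) :=
  Subtype.ext (funext fun u => H.transposeLp_regRepFiber F u)

lemma isometry_transposeFamily : Isometry H.transposeFamily :=
  AddMonoidHomClass.isometry_of_norm
    (AddMonoidHom.mk' H.transposeFamily H.transposeFamily_add) H.norm_transposeFamily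

/-- Transposition is continuous and maps the image of $C_c(G)$ into itself through $F\mapsto
F^\vee$, so it preserves the closure. -/
lemma transposeFamily_mem {T : H.OpFamily} (hT : T ∈ H.cstarRed) :
    H.transposeFamily T ∈ H.cstarRed := by
  refine map_mem_closure H.isometry_transposeFamily.continuous hT ?_
  rintro _ ⟨F, rfl⟩
  exact ⟨check F, (H.transposeFamily_regRep F).symm⟩

/-- The `*`-anti-automorphism of the reduced C*-algebra that extends `F ↦ F^∨`. -/
noncomputable def checkEquiv : H.cstarRed ≃⋆ₐ[ℂ] H.cstarRedᵐᵒᵖ where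
  toFun T := .op ⟨H.transposeFamily T, H.transposeFamily_mem T.2⟩
  invFun T := ⟨H.transposeFamily T.unop, H.transposeFamily_mem T.unop.2⟩
  left_inv T := Subtype.ext (H.transposeFamily_transposeFamily T)
  right_inv T := MulOpposite.unop_injective
    (Subtype.ext (H.transposeFamily_transposeFamily T.unop))
  map_mul' S T := MulOpposite.unop_injective (Subtype.ext (H.transposeFamily_mul S T))
  map_add' S T := MulOpposite.unop_injective (Subtype.ext (H.transposeFamily_add S T))
  map_smul' c T := MulOpposite.unop_injective (Subtype.ext (H.transposeFamily_smul c T))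
  map_star' T := MulOpposite.unop_injective (Subtype.ext (H.transposeFamily_star T))

lemma norm_toCstarRed_check (F : C_c(G, ℂ)) : ‖H.toCstarRed (check F)‖ = H.redNorm F := by
  rw [← norm_regRep, ← norm_transposeFamily, transposeFamily_regRep]
  rfl

lemma redNorm_le_iNorm (F : C_c(G, ℂ)) : H.redNorm F ≤ H.iNorm F := by
  -- Nonnegativity removes the maximum with 0 from the Schur bound, and it covers an empty unit
  -- space, where the real supremum is 0.
  have h0 : 0 ≤ H.iNorm F :=
    (Real.iSup_nonneg fun u => integral_nonneg fun t => norm_nonneg _).trans (le_max_left _ _)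
  exact Real.iSup_le (fun u => (H.norm_regRepFiber_le F u).trans_eq (max_eq_left h0)) h0

lemma dense_range_toCstarRed : DenseRange H.toCstarRed := by
  intro T
  rw [Metric.mem_closure_range_iff]
  intro ε hε
  obtain ⟨_, ⟨F, rfl⟩, hF⟩ := Metric.mem_closure_iff.1 T.2 ε hε
  exact ⟨F, hF⟩

/-- Completeness is what makes the isometric image in the operators on $E^2$ closed. -/
instance : CompleteSpace H.cstarRed :=
  (NonUnitalStarSubalgebra.isClosed_topologicalClosure H.regImage).completeSpace_coe

lemma check_surjective : Function.Surjective (check : C_c(G, ℂ) → C_c(G, ℂ)) :=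
  fun F => ⟨check F, check_check F⟩

/-! ### Right convolution operators and the closure of their image -/

/-- Right convolution by an element of `C_c(G)`, as an adjointable operator on `E²`. -/
noncomputable def rightConv : C_c(G, ℂ) →ₗ[ℂ] Adjointable C₀(G₀, ℂ) H.E2 where
  toFun F := H.moduleRep (H.toCstarRed (check F))
  map_add' F K := by
    rw [← map_add]
    exact congrArg _ (Subtype.ext (H.regRep_add (check F) (check K)))
  map_smul' c F := by
    rw [RingHom.id_apply, ← map_smul]
    exact congrArg _ (Subtype.ext (H.regRep_smul c (check F)))

lemma rightConv_apply (F : C_c(G, ℂ)) : H.rightConv F = H.moduleRep (H.toCstarRed (check F)) := rfl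

lemma rightConv_toE2 (f F : C_c(G, ℂ)) :
    (H.rightConv F).toCLM (H.toE2 f) = H.toE2 (H.conv f F) :=
  H.moduleRep_toCstarRed_check f F

/-- The order is reversed because $F\mapsto F^\vee$ is antimultiplicative. At the level of operators
this is the product rule for transposes, so no convolution integral has to be computed. -/
lemma rightConv_conv (F K : C_c(G, ℂ)) :
    H.rightConv (H.conv F K) = H.rightConv K * H.rightConv F := by
  simp only [rightConv_apply]
  rw [← map_mul]
  refine congrArg _ (Subtype.ext ?_)
  change H.regRep (check (H.conv F K)) = H.regRep (check K) * H.regRep (check F)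
  rw [← transposeFamily_regRep, regRep_conv, transposeFamily_mul, transposeFamily_regRep,
    transposeFamily_regRep]

lemma rightConv_invol (F : C_c(G, ℂ)) : H.rightConv (invol F) = star (H.rightConv F) := by
  rw [rightConv_apply, rightConv_apply, ← map_star]
  refine congrArg _ (Subtype.ext ?_)
  change H.regRep (check (invol F)) = star (H.regRep (check F))
  rw [← regRep_invol]
  -- The functions $(F^*)^\vee$ and $(F^\vee)^*$ are definitionally equal.
  rfl

/-- An isometry on a complete space commutes with closures. Its values on the dense image of
$C_c(G)$ are exactly the operators $R_F$, as $F\mapsto F^\vee$ permutes $C_c(G)$. -/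
lemma range_moduleRep :
    (NonUnitalStarAlgHom.range H.moduleRep : Set (Adjointable C₀(G₀, ℂ) H.E2)) =
      closure (Set.range H.rightConv) := by
  rw [NonUnitalStarAlgHom.coe_range]
  have hr : Set.range H.rightConv = H.moduleRep '' Set.range H.toCstarRed := by
    rw [← Set.range_comp, ← check_surjective.range_comp (H.moduleRep ∘ H.toCstarRed)]
    rfl
  rw [hr, H.isometry_moduleRep.isClosedEmbedding.closure_image_eq,
    H.dense_range_toCstarRed.closure_eq, Set.image_univ]

end TopologicalGroupoid.HaarSystem

/-! ### Assembly of the theorem -/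

/-- An isomorphism of `*`-algebras, as an isomorphism of the opposite algebras. -/
def StarAlgEquiv.mulOpposite {A B : Type*} [NonUnitalSemiring A] [NonUnitalSemiring B]
    [Module ℂ A] [Module ℂ B] [StarRing A] [StarRing B] (e : A ≃⋆ₐ[ℂ] B) :
    Aᵐᵒᵖ ≃⋆ₐ[ℂ] Bᵐᵒᵖ where
  toFun a := .op (e a.unop)
  invFun b := .op (e.symm b.unop)
  left_inv a := MulOpposite.unop_injective (e.symm_apply_apply a.unop)
  right_inv b := MulOpposite.unop_injective (e.apply_symm_apply b.unop)
  map_mul' a b := MulOpposite.unop_injective (map_mul e b.unop a.unop)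
  map_add' a b := MulOpposite.unop_injective (map_add e a.unop b.unop)
  map_smul' c a := MulOpposite.unop_injective (map_smul e c a.unop)
  map_star' a := MulOpposite.unop_injective (map_star e a.unop)

theorem proposition8 {G G₀ : Type*} [TopologicalSpace G] [TopologicalSpace G₀]
    [TopologicalGroupoid G G₀] [T2Space G] [LocallyCompactSpace G] [SecondCountableTopology G]
    [MeasurableSpace G] [BorelSpace G] (H : TopologicalGroupoid.HaarSystem G) :
    ∃ R : C_c(G, ℂ) →ₗ[ℂ] Adjointable C₀(G₀, ℂ) H.E2,
      -- `R F` is the unique bounded extension of `f ↦ f * F` from `C_c(G)` to `E²`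
      (∀ (F : C_c(G, ℂ)) (T : H.E2 →L[ℂ] H.E2),
        (∀ f : C_c(G, ℂ), T (H.toE2 f) = H.toE2 (H.conv f F)) ↔ T = (R F).toCLM) ∧
      (∀ F : C_c(G, ℂ), ‖R F‖ ≤ H.iNorm F) ∧
      -- `R` is a `*`-antirepresentation
      (∀ F K : C_c(G, ℂ), R (H.conv F K) = R K * R F) ∧
      (∀ F : C_c(G, ℂ), R (TopologicalGroupoid.HaarSystem.invol F) = star (R F)) ∧
      -- it is isometric for the reduced norm, and the closure `B` of its image is a
      -- `*`-algebra canonically isomorphic to the reduced C*-algebra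
      (∀ F : C_c(G, ℂ), ‖R F‖ = H.redNorm F) ∧
      ∃ B : NonUnitalStarSubalgebra ℂ (Adjointable C₀(G₀, ℂ) H.E2),
        (B : Set (Adjointable C₀(G₀, ℂ) H.E2)) = closure (Set.range R) ∧
        (∃ Φ : H.cstarRed ≃⋆ₐ[ℂ] B, Isometry Φ ∧
          ∀ F : C_c(G, ℂ),
            (Φ (H.toCstarRed (TopologicalGroupoid.HaarSystem.check F)) :
              Adjointable C₀(G₀, ℂ) H.E2) = R F) ∧
        (∃ Ψ : H.cstarRed ≃⋆ₐ[ℂ] Bᵐᵒᵖ, Isometry Ψ ∧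
          ∀ F : C_c(G, ℂ),
            ((Ψ (H.toCstarRed F)).unop : Adjointable C₀(G₀, ℂ) H.E2) = R F) := by
  let Φ := StarAlgEquiv.ofInjective' H.moduleRep H.isometry_moduleRep.injective
  have hΦ : Isometry Φ := H.isometry_moduleRep
  refine ⟨H.rightConv, fun F T => ⟨fun hT => ?_, ?_⟩, fun F => ?_, H.rightConv_conv,
    H.rightConv_invol, fun F => ?_, NonUnitalStarAlgHom.range H.moduleRep, H.range_moduleRep,
    -- The anti-isomorphism is transposition followed by `Φ`: $F\mapsto F^\vee\mapsto R_F$.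
    ⟨Φ, hΦ, fun F => rfl⟩, ⟨H.checkEquiv.trans Φ.mulOpposite, ?_, fun F => ?_⟩⟩
  -- Two continuous operators that agree on the dense subspace $C_c(G)$ coincide.
  · refine DFunLike.coe_injective (H.dense_range_toE2.equalizer T.continuous
      (H.rightConv F).toCLM.continuous (funext fun f => ?_))
    exact (hT f).trans (H.rightConv_toE2 f F).symm
  · rintro rfl f
    exact H.rightConv_toE2 f F
  · rw [TopologicalGroupoid.HaarSystem.rightConv_apply, H.norm_moduleRep,
      H.norm_toCstarRed_check]
    exact H.redNorm_le_iNorm F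
  · rw [TopologicalGroupoid.HaarSystem.rightConv_apply, H.norm_moduleRep,
      H.norm_toCstarRed_check]
  · exact Isometry.of_dist_eq fun S T => (hΦ.dist_eq _ _).trans
      (H.isometry_transposeFamily.dist_eq (S : H.OpFamily) T)
  · exact congrArg H.moduleRep (Subtype.ext (H.transposeFamily_regRep F))
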